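/- Terminology. Let $G$ be a finite group with identity $e$; for $X\subseteq G$ put $\underline{X}=\sum_{x\in X}x\in\mathbb{Z}G$. An S-ring over $G$ is a subring $\mathcal{A}$ of $\mathbb{Z}G$ for which there is a partition $\mathcal{S}(\mathcal{A})$ of $G$ (into the basic sets of $\mathcal{A}$) that contains $\{e\}$, is closed under $X\mapsto X^{-1}$, and satisfies $\mathcal{A}=\mathrm{Span}_{\mathbb{Z}}\{\underline{X}:X\in\mathcal{S}(\mathcal{A})\}$. An $\mathcal{A}$-subgroup is a subgroup $H\le G$ with $\underline{H}\in\mathcal{A}$; then $\mathcal{A}_H$ denotes the S-ring over $H$ whose basic sets are the basic sets of $\mathcal{A}$ contained in $H$. The radical of $X\subseteq G$ is $\mathrm{rad}(X)=\{g\in G: gX=Xg=X\}$. For a prime $p$, $\mathcal{A}$ is a $p$-S-ring if all its basic sets have $p$-power size. $\mathcal{A}$ is decomposable if there are $\mathcal{A}$-subgroups $L\le U'$ of $G$ with $L\ne\{e\}$, $U'\neq G$, $L\trianglelefteq G$, such that $L\le\mathrm{rad}(X)$ for every basic set $X\subseteq G\setminus U'$. For $X\subseteq G$ let $R(X)=\{(g,xg):x\in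 X,\ g\in G\}$. S-rings $\mathcal{A}$ over $G$ and $\mathcal{B}$ over $H$ are isomorphic, $\mathcal{A}\cong\mathcal{B}$, if some bijection $f:G\to H$ satisfies $\{R(X)^f:X\in\mathcal{S}(\mathcal{A})\}=\{R(Y):Y\in\mathcal{S}(\mathcal{B})\}$. $\mathrm{Aut}(\mathcal{A})$ is the group of all permutations $f$ of $G$ with $R(X)^f=R(X)$ for every $X\in\mathcal{S}(\mathcal{A})$, and $\mathrm{Aut}_G(\mathcal{A})=\mathrm{Aut}(\mathcal{A})\cap\mathrm{Aut}(G)$. For $U\le G$, $\mathrm{Aut}_G(\mathcal{A})^U$ denotes the set of permutations of $U$ induced by those elements of $\mathrm{Aut}_G(\mathcal{A})$ that map $U$ onto itself. Let $C_p$ be the cyclic group of order $p$. For S-rings $\mathcal{B}$ over $H$ and $\mathcal{C}$ over $K$, the wreath product $\mathcal{B}\wr\mathcal{C}$ is the S-ring over $H\times K$ whose basic sets are $X\times\{e\}$ with $X\in\mathcal{S}(\mathcal{B})$ and $H\times Y$ with $Y\in\mathcal{S}(\mathcal{C})$, $Y\ne\{e\}$. Let $\mathcal{D}_p$ be the S-ring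 over $C_p^3$ whose basic sets are the orbits of $\langle\sigma\rangle$, where $\sigma=\left(\begin{smallmatrix}1&1&0\\0&1&1\\0&0&1\end{smallmatrix}\right)\in\mathrm{Aut}(C_p^3)$. Statement. Let $p$ be a prime, $G\cong C_p^4$, and let $\mathcal{A}$ be a decomposable $p$-S-ring over $G$. Suppose that $U$ is an $\mathcal{A}$-subgroup with $\mathcal{A}_U\cong\mathbb{Z}C_p\wr\mathbb{Z}C_p\wr\mathbb{Z}C_p$ and that $\mathcal{A}$ has a basic set $X\subseteq G\setminus U$ with $\mathrm{rad}(X)=\{e\}$. Then $$\mathrm{Aut}_G(\mathcal{A})^U=\mathrm{Aut}_U(\mathcal{A}_U),$$ unless $p>2$ and there exist $\mathcal{A}$-subgroups $U_1$ and $U_2$ of $G$ of order $p^3$ such that $$\mathcal{A}_{U_1}\cong\mathcal{D}_p\quad\text{and}\quad\mathcal{A}_{U_2}\cong\mathbb{Z}C_p\wr\mathbb{Z}C_p^2.\qquad(*)$$ Moreover, $U$ contains a unique $\mathcal{A}$-subgroup $V$ of order $p^2$; and if $p>2$ and $U_1,U_2$ are any $\mathcal{A}$-subgroups of order $p^3$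 satisfying $(*)$, then every basic set of $\mathcal{A}$ contained in $G\setminus(U_1\cup U_2)$ is a coset of $V$. -/

import Mathlib

open scoped Pointwise

set_option linter.unusedSectionVars false

/-- The element `∑_{x ∈ X} x` of the integer group ring of a finite group. -/
noncomputable def groupRingSum {G : Type*} [Finite G] (X : Set G) : MonoidAlgebra ℤ G :=
  ∑ x ∈ X.toFinite.toFinset, MonoidAlgebra.single x 1

/-- An S-ring (Schur ring) over a finite group `G`: a subring of `ℤ G` spanned over `ℤ` by the
sums of the classes of a partition of `G` that contains `{e}` and is closed under inversion.
The classes are the basic sets. -/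
structure SRing (G : Type*) [Group G] [Finite G] where
  toSubring : Subring (MonoidAlgebra ℤ G)
  basicSets : Set (Set G)
  isPartition : Setoid.IsPartition basicSets
  singleton_one_mem : {1} ∈ basicSets
  inv_mem : ∀ X ∈ basicSets, X⁻¹ ∈ basicSets
  mem_iff_mem_span : ∀ a : MonoidAlgebra ℤ G,
    a ∈ toSubring ↔ a ∈ Submodule.span ℤ (groupRingSum '' basicSets)

/-- The set `R(X) = {(g, xg) : x ∈ X, g ∈ G}` of arcs of the Cayley digraph `Cay(G, X)`. -/
def cayleyArcs {G : Type*} [Group G] (X : Set G) : Set (G × G) :=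
  {q | ∃ g : G, ∃ x ∈ X, q = (g, x * g)}

/-- The radical `rad(X) = {g ∈ G : gX = Xg = X}`, as a set. -/
def setRadical {G : Type*} [Group G] (X : Set G) : Set G :=
  {g | g • X = X ∧ MulOpposite.op g • X = X}

/-- `Δ^U`: the permutations of the subgroup `U` induced by those elements of a set `Δ` of
permutations of `G` that map `U` onto itself. -/
def inducedPerms {G : Type*} [Group G] (Δ : Set (Equiv.Perm G)) (U : Subgroup G) :
    Set (Equiv.Perm U) :=
  {h | ∃ f ∈ Δ, f '' (U : Set G) = U ∧ ∀ u : U, (h u : G) = f u}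

namespace SRing

section Basics

variable {G : Type*} [Group G] [Finite G]

/-- `A`-subgroups: subgroups `H` whose element sum lies in `A`. -/
def IsASubgroup (A : SRing G) (H : Subgroup G) : Prop :=
  groupRingSum (H : Set G) ∈ A.toSubring

/-- `A` is a `p`-S-ring: every basic set has `p`-power size. -/
def IsPSRing (A : SRing G) (p : ℕ) : Prop :=
  ∀ X ∈ A.basicSets, ∃ k : ℕ, X.ncard = p ^ k

/-- `A` is the nontrivial generalized wreath product with respect to the `A`-section `U / L`. -/
def IsNontrivialWreath (A : SRing G) (U L : Subgroup G) : Prop :=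
  A.IsASubgroup U ∧ A.IsASubgroup L ∧ L ≤ U ∧ L.Normal ∧
    (∀ X ∈ A.basicSets, X ⊆ (U : Set G)ᶜ → (L : Set G) ⊆ setRadical X) ∧
    L ≠ ⊥ ∧ U ≠ ⊤

/-- `A` is decomposable: it is a nontrivial generalized wreath product for some `A`-section. -/
def IsDecomposable (A : SRing G) : Prop :=
  ∃ U L : Subgroup G, A.IsNontrivialWreath U L

/-- The automorphism group of `A`: the permutations of `G` that preserve every `R(X)`,
`X` a basic set. -/
def aut (A : SRing G) : Subgroup (Equiv.Perm G) where
  carrier := {f | ∀ X ∈ A.basicSets, Prod.map f f '' cayleyArcs X = cayleyArcs X}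
  one_mem' := by intro X _; simp
  mul_mem' := by
    intro f g hf hg X hX
    have h : (Prod.map (f * g : Equiv.Perm G) (f * g : Equiv.Perm G) : G × G → G × G) =
        Prod.map f f ∘ Prod.map g g := by
      ext q <;> simp
    rw [h, Set.image_comp, hg X hX, hf X hX]
  inv_mem' := by
    intro f hf X hX
    have h : (Prod.map (f⁻¹ : Equiv.Perm G) (f⁻¹ : Equiv.Perm G) : G × G → G × G) ∘ Prod.map f f
        = id := by
      ext q <;> simp
    conv_lhs => rw [← hf X hX]
    rw [← Set.image_comp, h, Set.image_id]

/-- The group `Aut_G(A) = Aut(A) ∩ Aut(G)`, as a group of permutations of `G`. -/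
def autGroup (A : SRing G) : Subgroup (Equiv.Perm G) :=
  A.aut ⊓ (MulAut.toPerm G).range

/-- `A ≅ B`: there is a (combinatorial) isomorphism from `A` to `B`, that is, a bijection `f` with
`{R(X)^f : X basic set of A} = {R(Y) : Y basic set of B}`. -/
def Isomorphic {H : Type*} [Group H] [Finite H] (A : SRing G) (B : SRing H) : Prop :=
  ∃ f : G ≃ H, (fun X => Prod.map f f '' cayleyArcs X) '' A.basicSets = cayleyArcs '' B.basicSets

end Basics

section Helpers

variable {G : Type*} [Group G] [Finite G]

theorem coeff_groupRingSum (X : Set G) (g : G) [Decidable (g ∈ X)] :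
    (groupRingSum X).coeff g = if g ∈ X then 1 else 0 := by
  classical
  simp [groupRingSum, Finsupp.finsetSum_apply, Finsupp.single_apply]

/-- The number of factorizations `z = x * y` with `x ∈ X` and `y ∈ Y`. -/
noncomputable def factorCount (X Y : Set G) (z : G) : ℕ :=
  {x | x ∈ X ∧ x⁻¹ * z ∈ Y}.ncard

theorem coeff_mul_groupRingSum (X Y : Set G) (z : G) :
    (groupRingSum X * groupRingSum Y).coeff z = (factorCount X Y z : ℤ) := by
  classical
  rw [groupRingSum, Finset.sum_mul, MonoidAlgebra.coeff_sum, Finsupp.finsetSum_apply]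
  simp only [MonoidAlgebra.coeff_single_mul_apply, one_mul, coeff_groupRingSum]
  rw [Finset.sum_boole, factorCount, Set.ncard_eq_toFinset_card _ (Set.toFinite _)]
  congr 2
  ext x
  simp

theorem mem_span_iff {S : Set (Set G)} (hS : Setoid.IsPartition S) (a : MonoidAlgebra ℤ G) :
    a ∈ Submodule.span ℤ (groupRingSum '' S) ↔
      ∀ X ∈ S, ∀ x ∈ X, ∀ y ∈ X, a.coeff x = a.coeff y := by
  classical
  constructor
  · intro h
    induction h using Submodule.span_induction with
    | mem b hb =>
      obtain ⟨Y, hY, rfl⟩ := hb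
      intro X hX x hx y hy
      have key : x ∈ Y ↔ y ∈ Y := by
        constructor
        · intro hxY
          rwa [(hS.2 x).unique ⟨hY, hxY⟩ ⟨hX, hx⟩]
        · intro hyY
          rwa [(hS.2 y).unique ⟨hY, hyY⟩ ⟨hX, hy⟩]
      simp [coeff_groupRingSum, key]
    | zero => simp
    | add b c _ _ hb hc =>
      intro X hX x hx y hy
      simp [hb X hX x hx y hy, hc X hX x hx y hy]
    | smul n b _ hb =>
      intro X hX x hx y hy
      rw [MonoidAlgebra.coeff_smul_apply, MonoidAlgebra.coeff_smul_apply, hb X hX x hx y hy]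
  · intro h
    have hfin : S.Finite := Set.toFinite S
    have hne : ∀ X ∈ S, X.Nonempty := fun X hX => Setoid.nonempty_of_mem_partition hS hX
    let r : Set G → G := fun X => if hX : X.Nonempty then hX.some else 1
    have hr : ∀ X ∈ S, r X ∈ X := by
      intro X hX
      simp only [r, dif_pos (hne X hX)]
      exact (hne X hX).some_mem
    have ha : a = ∑ X ∈ hfin.toFinset, a.coeff (r X) • groupRingSum X := by
      ext g
      obtain ⟨X, ⟨hX, hg⟩, huniq⟩ := hS.2 g
      rw [MonoidAlgebra.coeff_sum, Finsupp.finsetSum_apply, Finset.sum_eq_single X]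
      · rw [MonoidAlgebra.coeff_smul_apply, coeff_groupRingSum, if_pos hg,
          h X hX g hg (r X) (hr X hX), smul_eq_mul, mul_one]
      · intro Y hY hne'
        have : g ∉ Y := fun hgY => hne' (huniq Y ⟨hfin.mem_toFinset.1 hY, hgY⟩)
        rw [MonoidAlgebra.coeff_smul_apply, coeff_groupRingSum, if_neg this, smul_zero]
      · intro hX'
        exact absurd (hfin.mem_toFinset.2 hX) hX'
    rw [ha]
    refine Submodule.sum_mem _ fun X hX => Submodule.smul_mem _ _ (Submodule.subset_span ?_)
    exact ⟨X, hfin.mem_toFinset.1 hX, rfl⟩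

theorem mem_iff (A : SRing G) (a : MonoidAlgebra ℤ G) :
    a ∈ A.toSubring ↔ ∀ X ∈ A.basicSets, ∀ x ∈ X, ∀ y ∈ X, a.coeff x = a.coeff y :=
  (A.mem_iff_mem_span a).trans (mem_span_iff A.isPartition a)

theorem groupRingSum_mem (A : SRing G) {X : Set G} (hX : X ∈ A.basicSets) :
    groupRingSum X ∈ A.toSubring :=
  (A.mem_iff_mem_span _).2 (Submodule.subset_span ⟨X, hX, rfl⟩)

theorem groupRingSum_univ_mem (A : SRing G) : groupRingSum (Set.univ : Set G) ∈ A.toSubring := by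
  classical
  rw [mem_iff]
  intro X _ x _ y _
  simp [coeff_groupRingSum]

theorem factorCount_eq (A : SRing G) {X Y Z : Set G} (hX : groupRingSum X ∈ A.toSubring)
    (hY : groupRingSum Y ∈ A.toSubring) (hZ : Z ∈ A.basicSets) {z w : G} (hz : z ∈ Z)
    (hw : w ∈ Z) : factorCount X Y z = factorCount X Y w := by
  have h := (A.mem_iff _).1 (A.toSubring.mul_mem hX hY) Z hZ z hz w hw
  rw [coeff_mul_groupRingSum, coeff_mul_groupRingSum] at h
  exact_mod_cast h

/-- The S-ring with a given set of basic sets, from the constancy of the structure constants. -/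
noncomputable def ofPartition (S : Set (Set G)) (hS : Setoid.IsPartition S) (h1 : {1} ∈ S)
    (hinv : ∀ X ∈ S, X⁻¹ ∈ S)
    (hmul : ∀ X ∈ S, ∀ Y ∈ S, ∀ Z ∈ S, ∀ z ∈ Z, ∀ w ∈ Z, factorCount X Y z = factorCount X Y w) :
    SRing G where
  toSubring :=
    { carrier := {a | a ∈ Submodule.span ℤ (groupRingSum '' S)}
      zero_mem' := (Submodule.span ℤ (groupRingSum '' S)).zero_mem
      add_mem' := fun {x y} hx hy => (Submodule.span ℤ (groupRingSum '' S)).add_mem hx hy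
      neg_mem' := fun {x} hx => (Submodule.span ℤ (groupRingSum '' S)).neg_mem hx
      one_mem' := by
        refine Submodule.subset_span ⟨{1}, h1, ?_⟩
        have e : (Set.toFinite ({1} : Set G)).toFinset = {1} := by
          ext x
          simp
        rw [groupRingSum, e, Finset.sum_singleton, MonoidAlgebra.one_def]
      mul_mem' := by
        intro a b ha hb
        have hle : Submodule.span ℤ (groupRingSum '' S) * Submodule.span ℤ (groupRingSum '' S) ≤
            Submodule.span ℤ (groupRingSum '' S) := by
          rw [Submodule.span_mul_span, Submodule.span_le]
          rintro _ ⟨_, ⟨X, hX, rfl⟩, _, ⟨Y, hY, rfl⟩, rfl⟩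
          refine (mem_span_iff hS _).2 fun Z hZ z hz w hw => ?_
          simp only [coeff_mul_groupRingSum]
          exact_mod_cast hmul X hX Y hY Z hZ z hz w hw
        exact hle (Submodule.mul_mem_mul ha hb) }
  basicSets := S
  isPartition := hS
  singleton_one_mem := h1
  inv_mem := hinv
  mem_iff_mem_span := fun _ => Iff.rfl

end Helpers

section Constructions

variable {G : Type*} [Group G] [Finite G]

/-- The S-ring `A_U` over an `A`-subgroup `U`; its basic sets are the basic sets of `A` contained
in `U`. -/
noncomputable def restrict (A : SRing G) (U : Subgroup G) (hU : A.IsASubgroup U) : SRing U :=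
  ofPartition {Y : Set U | ((↑) '' Y : Set G) ∈ A.basicSets}
    (by
      classical
      constructor
      · intro h
        rw [Set.mem_ofPred_eq, Set.image_empty] at h
        exact A.isPartition.1 h
      · intro u
        obtain ⟨X, ⟨hX, hu⟩, huniq⟩ := A.isPartition.2 (u : G)
        have hXU : X ⊆ (U : Set G) := by
          intro x hx
          have h := (A.mem_iff _).1 hU X hX x hx u hu
          by_contra hxU
          rw [coeff_groupRingSum, coeff_groupRingSum, if_neg hxU,
            if_pos (show (u : G) ∈ (U : Set G) from u.2)] at h
          exact zero_ne_one h
        have himg : (Subtype.val '' (Subtype.val ⁻¹' X : Set U) : Set G) = X := by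
          rw [Set.image_preimage_eq_inter_range, Subtype.range_val, Set.inter_comm]
          exact Set.inter_eq_right.2 hXU
        refine ⟨Subtype.val ⁻¹' X, ⟨?_, hu⟩, ?_⟩
        · rw [Set.mem_ofPred_eq, himg]
          exact hX
        · rintro Y ⟨hY, huY⟩
          rw [← huniq _ ⟨hY, ⟨u, huY, rfl⟩⟩, Set.preimage_image_eq _ Subtype.val_injective])
    (by simpa using A.singleton_one_mem)
    (by
      intro Y hY
      have h := A.inv_mem _ hY
      have e : ((↑) '' Y⁻¹ : Set G) = ((↑) '' Y : Set G)⁻¹ := Set.image_inv U.subtype Y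
      rw [Set.mem_ofPred_eq, e]
      exact h)
    (by
      have key : ∀ (X Y : Set U) (z : U),
          factorCount X Y z = factorCount ((↑) '' X : Set G) ((↑) '' Y) (z : G) := by
        intro X Y z
        rw [factorCount, factorCount, ← Set.ncard_image_of_injective _ Subtype.val_injective]
        congr 1
        ext x
        constructor
        · rintro ⟨x, ⟨hx, hy⟩, rfl⟩
          exact ⟨⟨x, hx, rfl⟩, ⟨_, hy, rfl⟩⟩
        · rintro ⟨⟨x, hx, rfl⟩, ⟨y, hy, hxy⟩⟩
          refine ⟨x, ⟨hx, ?_⟩, rfl⟩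
          have : x⁻¹ * z = y := Subtype.ext hxy.symm
          rwa [this]
      intro X hX Y hY Z hZ z hz w hw
      rw [key, key]
      exact A.factorCount_eq (A.groupRingSum_mem hX) (A.groupRingSum_mem hY) hZ
        ⟨z, hz, rfl⟩ ⟨w, hw, rfl⟩)

/-- The cyclotomic S-ring `Cyc(M, G)`, `M ≤ Aut(G)`; its basic sets are the orbits of `M`. -/
noncomputable def cyc (M : Subgroup (MulAut G)) : SRing G :=
  ofPartition (Set.range fun g : G => MulAction.orbit M g)
    (by
      constructor
      · rintro ⟨g, hg⟩
        exact (MulAction.nonempty_orbit (M := M) g).ne_empty hg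
      · intro g
        refine ⟨MulAction.orbit M g, ⟨⟨g, rfl⟩, MulAction.mem_orbit_self g⟩, ?_⟩
        rintro _ ⟨⟨k, rfl⟩, hk⟩
        exact (MulAction.orbit_eq_iff.2 hk).symm)
    (by
      refine ⟨1, ?_⟩
      ext x
      constructor
      · rintro ⟨m, rfl⟩
        exact map_one (m : MulAut G)
      · rintro rfl
        exact MulAction.mem_orbit_self _)
    (by
      rintro _ ⟨g, rfl⟩
      refine ⟨g⁻¹, ?_⟩
      ext x
      constructor
      · rintro ⟨m, hm⟩
        refine ⟨m, ?_⟩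
        change m • g = x⁻¹
        rw [← show m • g⁻¹ = x from hm]
        exact ((congrArg _ (map_inv (m : MulAut G) g)).trans (inv_inv _)).symm
      · rintro ⟨m, hm⟩
        refine ⟨m, ?_⟩
        rw [← inv_inv x, ← show m • g = x⁻¹ from hm]
        exact map_inv (m : MulAut G) g)
    (by
      rintro _ ⟨a, rfl⟩ _ ⟨b, rfl⟩ _ ⟨c, rfl⟩ z hz w hw
      obtain ⟨m, rfl⟩ : ∃ m : M, m • z = w := by
        have hw' : w ∈ MulAction.orbit M c := hw
        rw [← MulAction.orbit_eq_iff.2 hz] at hw'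
        exact hw'
      rw [factorCount, factorCount,
        ← Set.ncard_image_of_injective _ (MulAction.injective m)]
      congr 1
      ext x
      have hmul : ∀ u v : G, m • (u * v) = m • u * m • v := fun u v => map_mul (m : MulAut G) u v
      have hinv : ∀ u : G, m • u⁻¹ = (m • u)⁻¹ := fun u => map_inv (m : MulAut G) u
      constructor
      · rintro ⟨x, ⟨hx, hy⟩, rfl⟩
        refine ⟨MulAction.mem_orbit_of_mem_orbit m hx, ?_⟩
        change (m • x)⁻¹ * m • z ∈ _
        rw [← hinv, ← hmul]
        exact MulAction.mem_orbit_of_mem_orbit m hy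
      · rintro ⟨hx, hy⟩
        obtain ⟨x, rfl⟩ : ∃ y, m • y = x := ⟨m⁻¹ • x, smul_inv_smul _ _⟩
        rw [← hinv, ← hmul] at hy
        refine ⟨x, ⟨?_, ?_⟩, rfl⟩
        · simpa using MulAction.mem_orbit_of_mem_orbit m⁻¹ hx
        · simpa using MulAction.mem_orbit_of_mem_orbit m⁻¹ hy)

/-- The integer group ring `ℤ G` as an S-ring; its basic sets are the singletons. -/
noncomputable def groupRing (G : Type*) [Group G] [Finite G] : SRing G :=
  ofPartition (Set.range fun g : G => ({g} : Set G))
    (by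
      constructor
      · rintro ⟨g, hg⟩
        exact Set.singleton_ne_empty g hg
      · intro g
        refine ⟨{g}, ⟨⟨g, rfl⟩, rfl⟩, ?_⟩
        rintro _ ⟨⟨k, rfl⟩, hk⟩
        rw [Set.mem_singleton_iff.1 hk])
    ⟨1, rfl⟩
    (by
      rintro _ ⟨g, rfl⟩
      exact ⟨g⁻¹, by simp⟩)
    (by
      rintro X _ Y _ _ ⟨g, rfl⟩ z rfl w rfl
      rfl)

theorem factorCount_prod {H K : Type*} [Group H] [Finite H] [Group K] [Finite K]
    (X₁ Y₁ : Set H) (X₂ Y₂ : Set K) (z : H × K) :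
    factorCount (X₁ ×ˢ X₂) (Y₁ ×ˢ Y₂) z = factorCount X₁ Y₁ z.1 * factorCount X₂ Y₂ z.2 := by
  rw [factorCount, factorCount, factorCount, ← Set.ncard_prod]
  congr 1
  ext ⟨x, y⟩
  simp only [Set.mem_ofPred_eq, Set.mem_prod, Prod.fst_mul, Prod.snd_mul, Prod.fst_inv,
    Prod.snd_inv]
  tauto

theorem factorCount_univ_left (Y : Set G) (z w : G) :
    factorCount Set.univ Y z = factorCount Set.univ Y w := by
  have key : ∀ z : G, factorCount Set.univ Y z = Y.ncard := by
    intro z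
    rw [factorCount, ← Set.ncard_image_of_injective Y
      (f := fun y : G => z * y⁻¹) (fun a b h => by simpa using h)]
    congr 1
    ext x
    constructor
    · rintro ⟨-, hx⟩
      exact ⟨_, hx, by simp⟩
    · rintro ⟨y, hy, rfl⟩
      exact ⟨trivial, by simpa using hy⟩
  rw [key, key]

theorem factorCount_univ_right (X : Set G) (z w : G) :
    factorCount X Set.univ z = factorCount X Set.univ w := by
  simp [factorCount]

/-- The wreath product `A ≀ B`, realized over the direct product `H × K`: its basic sets are the
sets `X × {e}` for `X` a basic set of `A`, and the full preimages `H × Y` of the basic sets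
`Y ≠ {e}` of `B`. -/
noncomputable def wreath {H K : Type*} [Group H] [Finite H] [Group K] [Finite K]
    (A : SRing H) (B : SRing K) : SRing (H × K) :=
  ofPartition
    ({W | ∃ X ∈ A.basicSets, W = X ×ˢ {1}} ∪
      {W | ∃ Y ∈ B.basicSets, Y ≠ {1} ∧ W = Set.univ ×ˢ Y})
    (by
      constructor
      · rintro (⟨X, hX, h⟩ | ⟨Y, hY, -, h⟩)
        · have := (Setoid.nonempty_of_mem_partition A.isPartition hX).prod
            (Set.singleton_nonempty (1 : K))
          exact this.ne_empty h.symm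
        · have := (Set.univ_nonempty (α := H)).prod
            (Setoid.nonempty_of_mem_partition B.isPartition hY)
          exact this.ne_empty h.symm
      · rintro ⟨h, k⟩
        by_cases hk : k = 1
        · subst hk
          obtain ⟨X, ⟨hX, hh⟩, huniq⟩ := A.isPartition.2 h
          refine ⟨X ×ˢ {1}, ⟨Or.inl ⟨X, hX, rfl⟩, hh, rfl⟩, ?_⟩
          rintro _ ⟨⟨X', hX', rfl⟩ | ⟨Y, hY, hne, rfl⟩, hm⟩
          · rw [huniq X' ⟨hX', hm.1⟩]
          · exact absurd ((B.isPartition.2 1).unique ⟨hY, hm.2⟩ ⟨B.singleton_one_mem, rfl⟩) hne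
        · obtain ⟨Y, ⟨hY, hk'⟩, huniq⟩ := B.isPartition.2 k
          refine ⟨Set.univ ×ˢ Y, ⟨Or.inr ⟨Y, hY, ?_, rfl⟩, trivial, hk'⟩, ?_⟩
          · rintro rfl
            exact hk hk'
          · rintro _ ⟨⟨X', hX', rfl⟩ | ⟨Y', hY', hne, rfl⟩, hm⟩
            · exact absurd hm.2 hk
            · rw [huniq Y' ⟨hY', hm.2⟩])
    (Or.inl ⟨{1}, A.singleton_one_mem, by simp [Prod.one_eq_mk]⟩)
    (by
      rintro _ (⟨X, hX, rfl⟩ | ⟨Y, hY, hne, rfl⟩)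
      · exact Or.inl ⟨X⁻¹, A.inv_mem X hX, by ext ⟨a, b⟩; simp⟩
      · refine Or.inr ⟨Y⁻¹, B.inv_mem Y hY, ?_, by ext ⟨a, b⟩; simp⟩
        intro h
        apply hne
        rw [← inv_inv Y, h]
        simp)
    (by
      -- every basic set is a product of an `A`-set and a basic set of `B`
      have hform : ∀ W ∈ ({W | ∃ X ∈ A.basicSets, W = X ×ˢ {1}} ∪
          {W | ∃ Y ∈ B.basicSets, Y ≠ {1} ∧ W = Set.univ ×ˢ Y} : Set (Set (H × K))),
          ∃ (P : Set H) (Q : Set K), W = P ×ˢ Q ∧ Q ∈ B.basicSets ∧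
            ((P ∈ A.basicSets ∧ Q = {1}) ∨ (P = Set.univ ∧ Q ≠ {1})) := by
        rintro _ (⟨X, hX, rfl⟩ | ⟨Y, hY, hne, rfl⟩)
        · exact ⟨X, {1}, rfl, B.singleton_one_mem, Or.inl ⟨hX, rfl⟩⟩
        · exact ⟨Set.univ, Y, rfl, hY, Or.inr ⟨rfl, hne⟩⟩
      intro X hX Y hY Z hZ z hz w hw
      obtain ⟨X₁, X₂, rfl, hX₂, hX⟩ := hform X hX
      obtain ⟨Y₁, Y₂, rfl, hY₂, hY⟩ := hform Y hY
      obtain ⟨Z₁, Z₂, rfl, hZ₂, hZ⟩ := hform Z hZ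
      rw [factorCount_prod, factorCount_prod,
        B.factorCount_eq (B.groupRingSum_mem hX₂) (B.groupRingSum_mem hY₂) hZ₂ hz.2 hw.2]
      rcases hX with ⟨hX₁, rfl⟩ | ⟨rfl, -⟩
      · rcases hY with ⟨hY₁, rfl⟩ | ⟨rfl, -⟩
        · rcases hZ with ⟨hZ₁, -⟩ | ⟨-, hne⟩
          · rw [A.factorCount_eq (A.groupRingSum_mem hX₁) (A.groupRingSum_mem hY₁) hZ₁ hz.1 hw.1]
          · have : factorCount ({1} : Set K) {1} w.2 = 0 := by
              rw [factorCount, Set.ncard_eq_zero]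
              ext x
              simp only [Set.mem_singleton_iff, Set.mem_ofPred_eq, Set.mem_empty_iff_false,
                iff_false, not_and]
              rintro rfl h1
              apply hne
              have hw1 : w.2 = 1 := by simpa using h1
              have hw2 := hw.2
              rw [hw1] at hw2
              exact (B.isPartition.2 1).unique ⟨hZ₂, hw2⟩ ⟨B.singleton_one_mem, rfl⟩
            rw [this, mul_zero, mul_zero]
        · rw [factorCount_univ_right X₁ z.1 w.1]
      · rw [factorCount_univ_left Y₁ z.1 w.1])

end Constructions

section Models

variable (p : ℕ) [Fact p.Prime]

/-- The cyclic group `C_p`, written multiplicatively. -/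
abbrev Cp (p : ℕ) : Type := Multiplicative (ZMod p)

/-- The S-ring `ℤ C_p ≀ ℤ C_p ≀ ℤ C_p` over `C_p ^ 3`. -/
noncomputable def wreathCpCpCp : SRing (Cp p × (Cp p × Cp p)) :=
  (groupRing (Cp p)).wreath ((groupRing (Cp p)).wreath (groupRing (Cp p)))

/-- The S-ring `ℤ C_p ≀ ℤ C_p ^ 2` over `C_p ^ 3`. -/
noncomputable def wreathCpCp2 : SRing (Cp p × (Cp p × Cp p)) :=
  (groupRing (Cp p)).wreath (groupRing (Cp p × Cp p))

/-- The matrix `σ`, an upper unitriangular Jordan block. -/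
def sigma : Matrix.SpecialLinearGroup (Fin 3) (ZMod p) :=
  ⟨!![1, 1, 0; 0, 1, 1; 0, 0, 1], by simp [Matrix.det_fin_three]⟩

/-- The automorphism of `C_p ^ 3` given by the matrix `σ`. -/
def sigmaAut : MulAut (Multiplicative (Fin 3 → ZMod p)) :=
  AddEquiv.toMultiplicative (Matrix.SpecialLinearGroup.toLin' (sigma p)).toAddEquiv

/-- The S-ring `D_p = Cyc(⟨σ⟩, C_p ^ 3)`. -/
noncomputable def Dp : SRing (Multiplicative (Fin 3 → ZMod p)) :=
  cyc (Subgroup.zpowers (sigmaAut p))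

/-- `U₁` and `U₂` are `A`-subgroups of order `p ^ 3` with `A_{U₁} ≅ D_p` and
`A_{U₂} ≅ ℤ C_p ≀ ℤ C_p ^ 2`. -/
def IsExceptionalPair {G : Type*} [Group G] [Finite G] (A : SRing G) (U₁ U₂ : Subgroup G) : Prop :=
  Nat.card U₁ = p ^ 3 ∧ Nat.card U₂ = p ^ 3 ∧
    ∃ (h₁ : A.IsASubgroup U₁) (h₂ : A.IsASubgroup U₂),
      (A.restrict U₁ h₁).Isomorphic (Dp p) ∧ (A.restrict U₂ h₂).Isomorphic (wreathCpCp2 p)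

end Models

end SRing

/-! Let `L < V < U`, of orders p, p², p³, be the flag carried by the iterated wreath product. In
`L`, `V \ L` and `U \ V` the basic sets are points, `L`-cosets and `V`-cosets. Decomposability,
together with the basic set X of trivial radical outside U, gives an `A`-subgroup W with `W ∩ U = V`
that contains X and outside which every basic set is `L`-invariant (`exists_complement`).

In coordinates `E a b c d` with U: a = 0, W: b = 0, V: a = b = 0, L: a = b = c = 0, both U and W
have index p. So each basic set of the p-S-ring stays in one `V`-coset, a plane (a, b). A plane with
b ≠ 0 is a basic set or splits into `L`-cosets (`plane_mem_or_isThin`). Splitting ("thin") planes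
are closed under addition, and (0, b) with b ≠ 0 is never thin. Automorphisms of `A_U` are
unitriangular, and extending one means choosing the image of `E 1 0 0 0`
(`autGroup_restrict_subset`).

If W \ U contains a one-element basic set, translating by it determines all basic sets, and the
extension may fix that element. Otherwise X is the graph of a function f on `ZMod p`. Since X X⁻¹
covers the `L`-cosets of `V \ L`, f is planar, hence p > 2 and f is quadratic
(`IsPlanar.exists_quadratic`, by power sums). Multipliers and translations by L turn X into all the
basic sets of W outside V, a family of parabolas (`exists_paraboloid`). If all planes with b ≠ 0 are
basic sets, shifting the parabola parameter extends every automorphism. If one of them is thin, W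
carries `Dp` and the span of V and the thin plane carries `wreathCpCp2`: the exceptional pair.

For the last claim, every exceptional pair has `U₁ = W` (`eq_W_of_isomorphic_Dp`). Unless all planes
outside W are basic sets anyway, `U₂` contains every thin plane with b ≠ 0, so outside the union
only whole `V`-cosets remain. -/

namespace SRing

/-! ### Basic sets and `A`-subgroups -/

section General

variable {G : Type*} [Group G] [Finite G]

theorem exists_basicSet (A : SRing G) (g : G) : ∃ X ∈ A.basicSets, g ∈ X := by
  obtain ⟨X, ⟨hX, hg⟩, -⟩ := A.isPartition.2 g
  exact ⟨X, hX, hg⟩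

theorem basicSet_unique (A : SRing G) {X Y : Set G} (hX : X ∈ A.basicSets)
    (hY : Y ∈ A.basicSets) {g : G} (hgX : g ∈ X) (hgY : g ∈ Y) : X = Y :=
  (A.isPartition.2 g).unique ⟨hX, hgX⟩ ⟨hY, hgY⟩

theorem basicSet_nonempty (A : SRing G) {X : Set G} (hX : X ∈ A.basicSets) : X.Nonempty :=
  Setoid.nonempty_of_mem_partition A.isPartition hX

theorem groupRingSum_mem_iff (A : SRing G) (S : Set G) :
    groupRingSum S ∈ A.toSubring ↔ ∀ X ∈ A.basicSets, ∀ x ∈ X, x ∈ S → X ⊆ S := by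
  classical
  rw [mem_iff]
  simp only [coeff_groupRingSum]
  constructor
  · intro h X hX x hx hxS y hy
    by_contra hyS
    have := h X hX x hx y hy
    simp [hxS, hyS] at this
  · intro h X hX x hx y hy
    have : x ∈ S ↔ y ∈ S := ⟨fun hs => h X hX x hx hs hy, fun hs => h X hX y hy hs hx⟩
    simp [this]

theorem IsASubgroup.subset {A : SRing G} {H : Subgroup G} (hH : A.IsASubgroup H) {X : Set G}
    (hX : X ∈ A.basicSets) {x : G} (hx : x ∈ X) (hxH : x ∈ H) : X ⊆ (H : Set G) :=
  (A.groupRingSum_mem_iff _).1 hH X hX x hx hxH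

theorem isASubgroup_iff (A : SRing G) (H : Subgroup G) :
    A.IsASubgroup H ↔ ∀ X ∈ A.basicSets, ∀ x ∈ X, x ∈ H → X ⊆ (H : Set G) :=
  A.groupRingSum_mem_iff _

/-- Every element of a basic set meeting `X * Y` is a product of elements of `X` and `Y`. -/
theorem exists_mul_of_mem (A : SRing G) {X Y Z : Set G} (hX : X ∈ A.basicSets)
    (hY : Y ∈ A.basicSets) (hZ : Z ∈ A.basicSets) {x y z : G} (hx : x ∈ X) (hy : y ∈ Y)
    (hxy : x * y ∈ Z) (hz : z ∈ Z) : ∃ x' ∈ X, ∃ y' ∈ Y, x' * y' = z := by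
  have h := A.factorCount_eq (A.groupRingSum_mem hX) (A.groupRingSum_mem hY) hZ hxy hz
  have hpos : 0 < factorCount X Y (x * y) := by
    rw [factorCount, Set.ncard_pos]
    exact ⟨x, hx, by simpa using hy⟩
  rw [h, factorCount, Set.ncard_pos] at hpos
  obtain ⟨x', hx', hy'⟩ := hpos
  exact ⟨x', hx', _, hy', by simp⟩

/-- With a one-point factor, products cannot spread: the basic set through `l * x` lies inside `l •
X`, and multiplying back by `l⁻¹` gives the reverse inclusion. -/
theorem smul_mem_basicSets (A : SRing G) {l : G} (hl : {l} ∈ A.basicSets) {X : Set G}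
    (hX : X ∈ A.basicSets) : l • X ∈ A.basicSets := by
  obtain ⟨x, hx⟩ := A.basicSet_nonempty hX
  obtain ⟨Z, hZ, hlx⟩ := A.exists_basicSet (l * x)
  have hl' : {l⁻¹} ∈ A.basicSets := by simpa using A.inv_mem _ hl
  suffices Z = l • X by rwa [← this]
  ext z
  rw [Set.mem_smul_set_iff_inv_smul_mem, smul_eq_mul]
  constructor
  · intro hz
    obtain ⟨l', rfl, y, hy, rfl⟩ := A.exists_mul_of_mem hl hX hZ rfl hx hlx hz
    simpa using hy
  · intro hz
    obtain ⟨l', rfl, y, hy, h⟩ := A.exists_mul_of_mem (x := l⁻¹) (y := l * x) (z := l⁻¹ * z)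
      hl' hZ hX rfl hlx (by simpa using hx) hz
    rwa [← mul_left_cancel h]

theorem singleton_mul_mem (A : SRing G) {k l : G} (hk : {k} ∈ A.basicSets)
    (hl : {l} ∈ A.basicSets) : {k * l} ∈ A.basicSets := by
  simpa using A.smul_mem_basicSets hk hl

theorem singleton_pow_mem (A : SRing G) {k : G} (hk : {k} ∈ A.basicSets) (n : ℕ) :
    {k ^ n} ∈ A.basicSets := by
  induction n with
  | zero => simpa using A.singleton_one_mem
  | succ n ih => rw [pow_succ]; exact A.singleton_mul_mem ih hk

theorem IsASubgroup.sup {G : Type*} [CommGroup G] [Finite G] {A : SRing G} {H K : Subgroup G}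
    (hH : A.IsASubgroup H) (hK : A.IsASubgroup K) : A.IsASubgroup (H ⊔ K) := by
  rw [isASubgroup_iff]
  intro X hX x hx hxH y hy
  obtain ⟨h, hh, k, hk, rfl⟩ := Subgroup.mem_sup.1 hxH
  obtain ⟨Y, hY, hhY⟩ := A.exists_basicSet h
  obtain ⟨Z, hZ, hkZ⟩ := A.exists_basicSet k
  obtain ⟨h', hh', k', hk', rfl⟩ := A.exists_mul_of_mem hY hZ hX hhY hkZ hx hy
  exact mul_mem (Subgroup.mem_sup_left (hH.subset hY hhY hh hh'))
    (Subgroup.mem_sup_right (hK.subset hZ hkZ hk hk'))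

/-- A basic set meets the cosets of an `A`-subgroup that it meets in equally many points. -/
theorem exists_ncard_eq_mul (A : SRing G) {H : Subgroup G} (hH : A.IsASubgroup H) {X : Set G}
    (hX : X ∈ A.basicSets) :
    ∃ c : ℕ, (∀ y ∈ X, {x ∈ X | x⁻¹ * y ∈ H}.ncard = c) ∧
      X.ncard = c * ((fun x : G => (x : G ⧸ H)) '' X).ncard := by
  classical
  obtain ⟨y₀, hy₀⟩ := A.basicSet_nonempty hX
  have hc : ∀ y ∈ X, {x ∈ X | x⁻¹ * y ∈ H}.ncard = {x ∈ X | x⁻¹ * y₀ ∈ H}.ncard := fun y hy =>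
    A.factorCount_eq (A.groupRingSum_mem hX) hH hX hy hy₀
  refine ⟨_, hc, ?_⟩
  have hXf := Set.toFinite X
  rw [Set.ncard_eq_toFinset_card X hXf,
    Finset.card_eq_sum_card_image (fun x : G => (x : G ⧸ H)) hXf.toFinset]
  rw [Finset.sum_const_nat (m := {x ∈ X | x⁻¹ * y₀ ∈ H}.ncard), mul_comm]
  · congr 1
    rw [Set.ncard_eq_toFinset_card _ (Set.toFinite _)]
    congr 1
    ext q
    simp
  · intro q hq
    obtain ⟨y, hy, rfl⟩ := Finset.mem_image.1 hq
    rw [← hc y (by simpa using hy), Set.ncard_eq_toFinset_card _ (Set.toFinite _)]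
    congr 1
    ext x
    simp [QuotientGroup.eq]

/-- In a `p`-S-ring, every basic set lies in one coset of an `A`-subgroup of index `p`. -/
theorem inv_mul_mem_of_index_eq {A : SRing G} {p : ℕ} (hp : p.Prime) (hA : A.IsPSRing p)
    {H : Subgroup G} (hH : A.IsASubgroup H) (hi : H.index = p) {X : Set G}
    (hX : X ∈ A.basicSets) {x y : G} (hx : x ∈ X) (hy : y ∈ X) : x⁻¹ * y ∈ H := by
  by_cases hxH : x ∈ H
  · exact mul_mem (H.inv_mem hxH) (hH.subset hX hx hxH hy)
  obtain ⟨c, -, hc⟩ := A.exists_ncard_eq_mul hH hX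
  obtain ⟨k, hk⟩ := hA X hX
  set T := (fun x : G => (x : G ⧸ H)) '' X with hT
  obtain ⟨m, -, hm⟩ := (Nat.dvd_prime_pow hp).1 (Dvd.intro_left c (hc.symm.trans hk))
  -- A basic set outside H misses the coset H, so it meets fewer than p cosets; the number met
  -- divides a power of p and must be 1.
  have hlt : T.ncard < p := by
    rw [← hi, Subgroup.index, ← Set.ncard_univ]
    refine Set.ncard_lt_ncard ?_ (Set.toFinite _)
    rw [Set.ssubset_univ_iff]
    intro h
    have h1 : ((1 : G) : G ⧸ H) ∈ T := h ▸ Set.mem_univ _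
    obtain ⟨g, hg, hg1⟩ := h1
    have hgH : g ∈ H := by simpa using (QuotientGroup.eq.1 hg1)
    exact hxH (hH.subset hX hg hgH hx)
  have hm0 : m = 0 := by
    by_contra h0
    have := Nat.le_self_pow h0 p
    omega
  rw [hm0, pow_zero, Set.ncard_eq_one] at hm
  obtain ⟨q, hq⟩ := hm
  have h1 : (x : G ⧸ H) = q := by
    have : (x : G ⧸ H) ∈ T := ⟨x, hx, rfl⟩
    rwa [hq] at this
  have h2 : (y : G ⧸ H) = q := by
    have : (y : G ⧸ H) ∈ T := ⟨y, hy, rfl⟩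
    rwa [hq] at this
  exact QuotientGroup.eq.1 (h1.trans h2.symm)

end General

/-! ### Schur multipliers -/

section Multipliers

variable {G : Type*} [CommGroup G] [Finite G]

/-- Schur's theorem on multipliers, for a prime multiplier. -/
theorem groupRingSum_image_pow_prime_mem (A : SRing G) {S : Set G}
    (hS : groupRingSum S ∈ A.toSubring) {q : ℕ} (hq : q.Prime) (hqG : (Nat.card G).Coprime q) :
    groupRingSum ((fun x : G => x ^ q) '' S) ∈ A.toSubring := by
  classical
  have : Fact q.Prime := ⟨hq⟩
  have hinj : Function.Injective (fun x : G => x ^ q) := fun x y h => by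
    have := (powCoprime hqG).injective (a₁ := x) (a₂ := y) (by simpa using h)
    exact this
  let φ : MonoidAlgebra ℤ G →+* MonoidAlgebra (ZMod q) G :=
    MonoidAlgebra.mapRingHom G (Int.castRingHom (ZMod q))
  have hφ : ∀ (a : MonoidAlgebra ℤ G) (g : G), (φ a).coeff g = (a.coeff g : ZMod q) := by
    intro a g
    simp [φ]
  -- Frobenius modulo q: the q-th power of a sum is the sum of the q-th powers. The target
  -- coefficients are 0 or 1, so constancy modulo q on basic sets is constancy.
  have key : φ (groupRingSum S ^ q) = φ (groupRingSum ((fun x : G => x ^ q) '' S)) := by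
    have : CharP (MonoidAlgebra (ZMod q) G) q := by
      exact charP_of_injective_algebraMap (R := ZMod q) (FaithfulSMul.algebraMap_injective _ _) q
    rw [map_pow, groupRingSum, groupRingSum, map_sum, map_sum, sum_pow_char]
    have e : (Set.toFinite ((fun x : G => x ^ q) '' S)).toFinset =
        (Set.toFinite S).toFinset.image (fun x : G => x ^ q) := by
      ext; simp
    rw [e, Finset.sum_image (fun x _ y _ h => hinj h)]
    refine Finset.sum_congr rfl fun x _ => ?_
    simp [φ, MonoidAlgebra.single_pow]
  rw [mem_iff]
  intro X hX x hx y hy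
  have h1 := (A.mem_iff _).1 (pow_mem hS q) X hX x hx y hy
  have h2 : ((groupRingSum ((fun x : G => x ^ q) '' S)).coeff x : ZMod q) =
      ((groupRingSum ((fun x : G => x ^ q) '' S)).coeff y : ZMod q) := by
    rw [← hφ, ← hφ, ← key, hφ, hφ, h1]
  rw [coeff_groupRingSum, coeff_groupRingSum] at h2 ⊢
  split_ifs at h2 ⊢ <;> simp_all

/-- Schur's theorem on multipliers. -/
theorem groupRingSum_image_pow_mem (A : SRing G) {n : ℕ} (hn : (Nat.card G).Coprime n) :
    ∀ {S : Set G}, groupRingSum S ∈ A.toSubring →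
      groupRingSum ((fun x : G => x ^ n) '' S) ∈ A.toSubring := by
  induction n using Nat.recOnMul with
  | zero =>
    intro S hS
    have h1 : Nat.card G = 1 := by simpa using hn
    have := (Nat.card_eq_one_iff_unique.1 h1).1
    have : (fun x : G => x ^ 0) '' S = S := by
      have : (fun x : G => x ^ 0) = id := Subsingleton.elim _ _
      rw [this, Set.image_id]
    rwa [this]
  | one => intro S hS; simpa using hS
  | prime q hq => intro S hS; exact A.groupRingSum_image_pow_prime_mem hS hq hn
  | mul a b iha ihb =>
    intro S hS
    have := ihb (Nat.Coprime.coprime_mul_left_right hn)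
      (iha (Nat.Coprime.coprime_mul_right_right hn) hS)
    rw [Set.image_image] at this
    simpa only [pow_mul] using this

end Multipliers

/-! ### Automorphisms and isomorphisms of S-rings -/

section Automorphisms

variable {G H : Type*} [Group G] [Finite G] [Group H] [Finite H]

theorem mem_cayleyArcs {G : Type*} [Group G] {X : Set G} {g h : G} :
    (g, h) ∈ cayleyArcs X ↔ h * g⁻¹ ∈ X := by
  constructor
  · rintro ⟨g', x, hx, h⟩
    obtain ⟨rfl, rfl⟩ := Prod.mk.inj h
    simpa using hx
  · intro hx
    exact ⟨g, _, hx, by simp⟩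

theorem image_cayleyArcs_mulEquiv {G H : Type*} [Group G] [Group H] (e : G ≃* H) (X : Set G) :
    Prod.map e e '' cayleyArcs X = cayleyArcs (e '' X) := by
  ext ⟨a, b⟩
  rw [mem_cayleyArcs]
  constructor
  · rintro ⟨⟨g, h⟩, hg, hab⟩
    obtain ⟨rfl, rfl⟩ := Prod.mk.inj hab
    exact ⟨h * g⁻¹, mem_cayleyArcs.1 hg, by simp⟩
  · rintro ⟨x, hx, hab⟩
    refine ⟨(e.symm a, e.symm b), mem_cayleyArcs.2 ?_, by simp⟩
    rwa [← map_inv, ← map_mul, ← hab, e.symm_apply_apply]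

theorem cayleyArcs_injective {G : Type*} [Group G] :
    Function.Injective (cayleyArcs : Set G → Set (G × G)) := by
  intro X Y h
  ext x
  have := Set.ext_iff.1 h (1, x)
  simpa [mem_cayleyArcs] using this

/-- A group automorphism carries the arcs of X to the arcs of its image, and by finiteness mapping X
into itself is the same as fixing it. -/
theorem mem_autGroup_iff (A : SRing G) (f : Equiv.Perm G) :
    f ∈ A.autGroup ↔ ∃ φ : MulAut G, (∀ g, φ g = f g) ∧ ∀ X ∈ A.basicSets, ∀ x ∈ X, φ x ∈ X := by
  constructor
  · rintro ⟨hf, φ, rfl⟩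
    refine ⟨φ, fun g => rfl, fun X hX x hx => ?_⟩
    have h := hf X hX
    have h' : Prod.map φ φ '' cayleyArcs X = cayleyArcs X := h
    rw [image_cayleyArcs_mulEquiv] at h'
    rw [← cayleyArcs_injective h']
    exact ⟨x, hx, rfl⟩
  · rintro ⟨φ, hφ, h⟩
    have hf : f = MulAut.toPerm G φ := by ext g; exact (hφ g).symm
    subst hf
    refine ⟨fun X hX => ?_, φ, rfl⟩
    have hX' : φ '' X = X := by
      refine Set.eq_of_subset_of_ncard_le ?_ ?_ (Set.toFinite _)
      · rintro _ ⟨x, hx, rfl⟩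
        exact h X hX x hx
      · rw [Set.ncard_image_of_injective _ φ.injective]
    have := image_cayleyArcs_mulEquiv φ X
    rw [hX'] at this
    exact this

theorem Isomorphic.of_mulEquiv {A : SRing G} {B : SRing H} (e : G ≃* H)
    (h : ∀ X ∈ A.basicSets, e '' X ∈ B.basicSets) : A.Isomorphic B := by
  refine ⟨e.toEquiv, ?_⟩
  ext R
  constructor
  · rintro ⟨X, hX, rfl⟩
    exact ⟨e '' X, h X hX, (image_cayleyArcs_mulEquiv e X).symm⟩
  · rintro ⟨Y, hY, rfl⟩
    obtain ⟨y, hy⟩ := B.basicSet_nonempty hY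
    obtain ⟨X, hX, hx⟩ := A.exists_basicSet (e.symm y)
    refine ⟨X, hX, ?_⟩
    rw [B.basicSet_unique hY (h X hX) hy ⟨_, hx, by simp⟩]
    exact image_cayleyArcs_mulEquiv e X

/-- An isomorphism of S-rings can be normalized to preserve the identity; it then maps basic
sets to basic sets. -/
theorem Isomorphic.exists_normalized {A : SRing G} {B : SRing H} (h : A.Isomorphic B) :
    ∃ f : G ≃ H, f 1 = 1 ∧ ∀ X ∈ A.basicSets, f '' X ∈ B.basicSets ∧
      ∀ g h : G, h * g⁻¹ ∈ X ↔ f h * (f g)⁻¹ ∈ f '' X := by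
  obtain ⟨f, hf⟩ := h
  refine ⟨f.trans (Equiv.mulRight (f 1)⁻¹), by simp, fun X hX => ?_⟩
  have hm : Prod.map f f '' cayleyArcs X ∈ cayleyArcs '' B.basicSets := hf ▸ ⟨X, hX, rfl⟩
  obtain ⟨Y, hY, hYX⟩ := hm
  have key : ∀ g h : G, h * g⁻¹ ∈ X ↔ f h * (f g)⁻¹ ∈ Y := by
    intro g h
    rw [← mem_cayleyArcs, ← mem_cayleyArcs, hYX]
    constructor
    · intro hh
      exact ⟨_, hh, rfl⟩
    · rintro ⟨⟨a, b⟩, hab, e⟩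
      obtain ⟨e1, e2⟩ := Prod.mk.inj e
      rwa [← f.injective e1, ← f.injective e2]
  have himg : (f.trans (Equiv.mulRight (f 1)⁻¹)) '' X = Y := by
    ext y
    constructor
    · rintro ⟨x, hx, rfl⟩
      have := (key 1 x).1 (by simpa using hx)
      simpa using this
    · intro hy
      refine ⟨f.symm (y * f 1), ?_, by simp⟩
      have := (key 1 (f.symm (y * f 1))).2 (by simpa using hy)
      simpa using this
  rw [himg]
  refine ⟨hY, fun g h => ?_⟩
  rw [key]
  simp

/-- A normalized isomorphism need not be a homomorphism, but both elements lie in the same basic set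
of B, which K contains or misses. This is enough to pull subgroups back. -/
theorem preimage_mul_inv_mem_iff {A : SRing G} {B : SRing H} {f : G ≃ H}
    (hf : ∀ X ∈ A.basicSets, f '' X ∈ B.basicSets ∧
      ∀ g h : G, h * g⁻¹ ∈ X ↔ f h * (f g)⁻¹ ∈ f '' X)
    {K : Subgroup H} (hK : B.IsASubgroup K) (g h : G) :
    f (h * g⁻¹) ∈ K ↔ f h * (f g)⁻¹ ∈ K := by
  obtain ⟨X, hX, hx⟩ := A.exists_basicSet (h * g⁻¹)
  have h1 := ((hf X hX).2 g h).1 hx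
  have h2 : f (h * g⁻¹) ∈ f '' X := ⟨_, hx, rfl⟩
  exact ⟨fun hh => hK.subset (hf X hX).1 h2 hh h1, fun hh => hK.subset (hf X hX).1 h1 hh h2⟩

/-- The preimage of a `B`-subgroup under a normalized isomorphism. -/
def comapSubgroup {A : SRing G} {B : SRing H} {f : G ≃ H} (hf1 : f 1 = 1)
    (hf : ∀ X ∈ A.basicSets, f '' X ∈ B.basicSets ∧
      ∀ g h : G, h * g⁻¹ ∈ X ↔ f h * (f g)⁻¹ ∈ f '' X)
    {K : Subgroup H} (hK : B.IsASubgroup K) : Subgroup G :=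
  Subgroup.ofDiv {g | f g ∈ K} ⟨1, by simp [hf1]⟩ (by
    intro g hg h hh
    have := (preimage_mul_inv_mem_iff hf hK h g).2 (mul_mem hg (K.inv_mem hh))
    exact this)

end Automorphisms

end SRing

/-! ### Planar functions over `ZMod p` are quadratic -/

section PlanarFunctions

open Polynomial

theorem ZMod.two_sub_comm : ∀ a b : ZMod 2, a - b = b - a := by decide

variable {p : ℕ} [Fact p.Prime]

theorem ZMod.sum_pow_prime_sub_one : ∑ x : ZMod p, x ^ (p - 1) = -1 := by
  have hp := (Fact.out : p.Prime)
  have h : ∀ x : ZMod p, x ^ (p - 1) = 1 - if x = 0 then 1 else 0 := by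
    intro x
    split_ifs with hx
    · rw [hx, zero_pow (by have := hp.two_le; omega), sub_self]
    · rw [ZMod.pow_card_sub_one_eq_one hx, sub_zero]
  simp_rw [h]
  simp

theorem ZMod.sum_pow_eq_zero {n : ℕ} (hn : n < p - 1) : ∑ x : ZMod p, x ^ n = 0 := by
  have := FiniteField.sum_pow_lt_card_sub_one (K := ZMod p) n (by simpa [ZMod.card] using hn)
  exact this

/-- The sum of the values of a polynomial of degree at most `p - 1` over `ZMod p`. -/
theorem ZMod.sum_eval_eq (F : (ZMod p)[X]) (hF : F.natDegree ≤ p - 1) :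
    ∑ x : ZMod p, F.eval x = -F.coeff (p - 1) := by
  have hlt : F.natDegree < p - 1 + 1 := by omega
  simp_rw [eval_eq_sum_range' hlt]
  rw [Finset.sum_comm, Finset.sum_range_succ, ← Finset.mul_sum, ZMod.sum_pow_prime_sub_one,
    Finset.sum_eq_zero]
  · simp
  · intro i hi
    rw [← Finset.mul_sum, ZMod.sum_pow_eq_zero (Finset.mem_range.1 hi), mul_zero]

theorem ZMod.exists_polynomial (f : ZMod p → ZMod p) :
    ∃ F : (ZMod p)[X], F.natDegree ≤ p - 1 ∧ ∀ x, F.eval x = f x := by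
  refine ⟨Lagrange.interpolate Finset.univ id f, ?_, fun x =>
    Lagrange.eval_interpolate_at_node f (fun _ _ _ _ h => h) (Finset.mem_univ x)⟩
  have h := Lagrange.degree_interpolate_le (s := Finset.univ) (v := id) f
    (fun (_ : ZMod p) _ _ _ h => h)
  rw [Finset.card_univ, ZMod.card] at h
  exact natDegree_le_of_degree_le h

theorem ZMod.polynomial_eq_zero (F : (ZMod p)[X]) (hF : F.natDegree ≤ p - 1)
    (h : ∀ x, F.eval x = 0) : F = 0 := by
  have hp := (Fact.out : p.Prime).two_le
  refine eq_zero_of_natDegree_lt_card_of_eval_eq_zero F Function.injective_id h ?_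
  rw [ZMod.card]
  omega

/-- A function is planar if all its nontrivial difference functions are bijective. -/
def IsPlanar (f : ZMod p → ZMod p) : Prop :=
  ∀ d : ZMod p, d ≠ 0 → Function.Bijective fun i => f (i + d) - f i

theorem IsPlanar.two_lt {f : ZMod p → ZMod p} (hf : IsPlanar f) : 2 < p := by
  have hp := (Fact.out : p.Prime)
  refine lt_of_le_of_ne hp.two_le fun h2 => ?_
  subst h2
  have h := (hf 1 one_ne_zero).injective (a₁ := 0) (a₂ := 1)
  have := h (by
    rw [zero_add, show (1 : ZMod 2) + 1 = 0 from rfl]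
    exact ZMod.two_sub_comm _ _)
  exact zero_ne_one this

/-- Put y = x + d. For d ≠ 0 the difference runs once through `ZMod p` as x does, the term b * x
only adding the constant b * d; so the inner sums are complete power sums. -/
theorem IsPlanar.sum_sum_sub_pow {f : ZMod p → ZMod p} (hf : IsPlanar f) (b : ZMod p) {n : ℕ}
    (hn : n ≤ p - 1) :
    ∑ x : ZMod p, ∑ y : ZMod p, ((f y + b * y) - (f x + b * x)) ^ n =
      if n = p - 1 then 1 else 0 := by
  have hp := (Fact.out : p.Prime).two_le
  have h1 : ∀ x : ZMod p, ∑ y : ZMod p, ((f y + b * y) - (f x + b * x)) ^ n =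
      ∑ d : ZMod p, ((f (x + d) + b * (x + d)) - (f x + b * x)) ^ n := fun x =>
    (Equiv.sum_comp (Equiv.addLeft x) fun y => ((f y + b * y) - (f x + b * x)) ^ n).symm
  simp_rw [h1]
  rw [Finset.sum_comm]
  have h2 : ∀ d : ZMod p, ∑ x : ZMod p, ((f (x + d) + b * (x + d)) - (f x + b * x)) ^ n =
      if d = 0 then 0 else ∑ t : ZMod p, t ^ n := by
    intro d
    split_ifs with hd
    · subst hd
      simp
    · have hb : Function.Bijective fun x => (f (x + d) - f x) + b * d :=
        (Equiv.addRight (b * d)).bijective.comp (hf d hd)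
      refine Eq.trans ?_ (Equiv.sum_comp (Equiv.ofBijective _ hb) fun t => t ^ n)
      refine Finset.sum_congr rfl fun x _ => ?_
      change _ = (f (x + d) - f x + b * d) ^ n
      ring
  simp_rw [h2]
  split_ifs with h
  · rw [h, ZMod.sum_pow_prime_sub_one]
    have : ∀ d : ZMod p, (if d = 0 then 0 else (-1 : ZMod p)) = -1 + if d = 0 then 1 else 0 := by
      intro d; split_ifs <;> simp
    simp_rw [this]
    simp [Finset.sum_add_distrib]
  · rw [ZMod.sum_pow_eq_zero (by omega)]
    simp

/-- In the binomial expansion every term but the middle one contains a power sum of exponent below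
j. -/
theorem ZMod.sum_sum_sub_pow (A : ZMod p → ZMod p) {j : ℕ}
    (h : ∀ i < j, ∑ x, A x ^ i = 0) :
    ∑ x : ZMod p, ∑ y : ZMod p, (A y - A x) ^ (2 * j) =
      (-1) ^ j * ((2 * j).choose j : ZMod p) * (∑ x, A x ^ j) ^ 2 := by
  simp_rw [sub_eq_add_neg, add_pow]
  have h1 : ∀ x : ZMod p, ∑ y : ZMod p, ∑ m ∈ Finset.range (2 * j + 1),
      A y ^ m * (-A x) ^ (2 * j - m) * ((2 * j).choose m : ZMod p) =
      ∑ m ∈ Finset.range (2 * j + 1), (∑ y : ZMod p, A y ^ m) *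
        ((-A x) ^ (2 * j - m) * ((2 * j).choose m : ZMod p)) := by
    intro x
    rw [Finset.sum_comm]
    refine Finset.sum_congr rfl fun m _ => ?_
    rw [Finset.sum_mul]
    exact Finset.sum_congr rfl fun y _ => by ring
  simp_rw [h1]
  rw [Finset.sum_comm, Finset.sum_eq_single j]
  · have h2 : 2 * j - j = j := by omega
    rw [h2, ← Finset.mul_sum, ← Finset.sum_mul]
    simp_rw [neg_pow (A _) j]
    rw [← Finset.mul_sum]
    ring
  · intro m hm hmj
    have hm' := Finset.mem_range.1 hm
    rw [← Finset.mul_sum, ← Finset.sum_mul]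
    rcases lt_or_gt_of_ne hmj with hlt | hgt
    · rw [h m hlt, zero_mul]
    · simp_rw [neg_pow (A _) (2 * j - m)]
      rw [← Finset.mul_sum, h (2 * j - m) (by omega)]
      simp
  · intro hj
    exact absurd (Finset.mem_range.2 (by omega)) hj

theorem ZMod.choose_ne_zero {n k : ℕ} (hn : n < p) (hk : k ≤ n) : (n.choose k : ZMod p) ≠ 0 := by
  have hp := (Fact.out : p.Prime)
  rw [Ne, ZMod.natCast_eq_zero_iff]
  intro h
  have h1 : p ∣ n.factorial := by
    rw [← Nat.choose_mul_factorial_mul_factorial hk]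
    exact Dvd.dvd.mul_right (Dvd.dvd.mul_right h _) _
  exact absurd ((hp.dvd_factorial).1 h1) (by omega)

/-- By induction on j only the square of this sum survives in the double sum, with a central
binomial coefficient that is nonzero modulo p; the double sum itself vanishes. -/
theorem IsPlanar.sum_pow_eq_zero {f : ZMod p → ZMod p} (hf : IsPlanar f) (b : ZMod p) {j : ℕ}
    (hj : 2 * j < p - 1) : ∑ x, (f x + b * x) ^ j = 0 := by
  induction j using Nat.strong_induction_on with
  | _ j ih =>
    have h1 := hf.sum_sum_sub_pow b (n := 2 * j) (by omega)
    rw [ZMod.sum_sum_sub_pow (fun x => f x + b * x) (fun i hi => ih i hi (by omega)),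
      if_neg (by omega)] at h1
    have h2 := ZMod.choose_ne_zero (p := p) (n := 2 * j) (k := j) (by omega) (by omega)
    have h3 : ((-1) ^ j : ZMod p) ≠ 0 := pow_ne_zero _ (neg_ne_zero.2 one_ne_zero)
    exact pow_eq_zero_iff (two_ne_zero) |>.1
      ((mul_eq_zero.1 h1).resolve_left (mul_ne_zero h3 h2))

/-- The polynomial whose value at `b` is `∑ x, (f x + b * x) ^ j`. -/
noncomputable def momentPolynomial (f : ZMod p → ZMod p) (j : ℕ) : (ZMod p)[X] :=
  ∑ s ∈ Finset.range (j + 1),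
    C ((∑ x : ZMod p, x ^ s * f x ^ (j - s)) * (j.choose s : ZMod p)) * X ^ s

theorem eval_momentPolynomial (f : ZMod p → ZMod p) (j : ℕ) (b : ZMod p) :
    (momentPolynomial f j).eval b = ∑ x, (f x + b * x) ^ j := by
  rw [momentPolynomial, eval_finsetSum]
  simp_rw [add_comm (f _), add_pow]
  rw [Finset.sum_comm]
  refine Finset.sum_congr rfl fun s _ => ?_
  simp only [eval_mul, eval_C, eval_pow, eval_X, Finset.sum_mul]
  exact Finset.sum_congr rfl fun x _ => by ring

theorem natDegree_momentPolynomial (f : ZMod p → ZMod p) (j : ℕ) :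
    (momentPolynomial f j).natDegree ≤ j :=
  natDegree_sum_le_of_forall_le _ _ fun _ hs =>
    (natDegree_C_mul_X_pow_le _ _).trans (Nat.lt_succ_iff.1 (Finset.mem_range.1 hs))

theorem coeff_momentPolynomial (f : ZMod p → ZMod p) {j s : ℕ} (hs : s ≤ j) :
    (momentPolynomial f j).coeff s =
      (∑ x : ZMod p, x ^ s * f x ^ (j - s)) * (j.choose s : ZMod p) := by
  rw [momentPolynomial, finsetSum_coeff]
  simp only [coeff_C_mul, coeff_X_pow, mul_ite, mul_one, mul_zero]
  rw [Finset.sum_ite_eq, if_pos (Finset.mem_range.2 (by omega))]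

/-- The power sum of f + b x vanishes for all b, so as a polynomial in b of small degree it is zero;
the mixed moments are its coefficients up to binomials. -/
theorem IsPlanar.moment_eq_zero {f : ZMod p → ZMod p} (hf : IsPlanar f) {r s : ℕ}
    (h : 2 * (r + s) < p - 1) : ∑ x : ZMod p, x ^ s * f x ^ r = 0 := by
  have h0 : momentPolynomial f (r + s) = 0 := by
    refine ZMod.polynomial_eq_zero _ ?_ fun b => ?_
    · exact (natDegree_momentPolynomial f _).trans (by omega)
    · rw [eval_momentPolynomial, hf.sum_pow_eq_zero b h]
  have h1 := coeff_momentPolynomial f (j := r + s) (s := s) (by omega)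
  rw [h0, coeff_zero, Nat.add_sub_cancel] at h1
  exact (mul_eq_zero.1 h1.symm).resolve_right (ZMod.choose_ne_zero (by omega) (by omega))

/-- At exponent (p - 1) / 2 the square of the moment polynomial is constant in b. It has degree at
most p - 1, so it is a constant polynomial, and so is its root; the coefficients of positive degree
vanish. -/
theorem IsPlanar.middle_moment_eq_zero {f : ZMod p → ZMod p} (hf : IsPlanar f) {h : ℕ}
    (hh : 2 * h = p - 1) {s r : ℕ} (hs : 0 < s) (hrs : r + s = h) :
    ∑ x : ZMod p, x ^ s * f x ^ r = 0 := by
  have hp := (Fact.out : p.Prime).two_le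
  have hc := ZMod.choose_ne_zero (p := p) (n := 2 * h) (k := h) (by omega) (by omega)
  have h3 : ((-1) ^ h : ZMod p) ≠ 0 := pow_ne_zero _ (neg_ne_zero.2 one_ne_zero)
  set k : ZMod p := (-1) ^ h * ((2 * h).choose h : ZMod p) with hk
  have hk0 : k ≠ 0 := mul_ne_zero h3 hc
  have h0 : momentPolynomial f h ^ 2 - C k⁻¹ = 0 := by
    refine ZMod.polynomial_eq_zero _ ?_ fun b => ?_
    · refine (natDegree_sub_C).le.trans (natDegree_pow_le.trans ?_)
      have := natDegree_momentPolynomial f h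
      omega
    · have h1 := hf.sum_sum_sub_pow b (n := 2 * h) (by omega)
      rw [ZMod.sum_sum_sub_pow (fun x => f x + b * x)
        (fun i hi => hf.sum_pow_eq_zero b (by omega)), if_pos hh, ← hk] at h1
      rw [eval_sub, eval_pow, eval_C, eval_momentPolynomial, sub_eq_zero]
      exact eq_inv_of_mul_eq_one_right h1
  have h1 : (momentPolynomial f h).natDegree = 0 := by
    have := congrArg natDegree (sub_eq_zero.1 h0)
    rw [natDegree_pow, natDegree_C] at this
    omega
  have h2 := coeff_momentPolynomial f (j := h) (s := s) (by omega)
  rw [coeff_eq_zero_of_natDegree_lt (by omega), show h - s = r by omega] at h2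
  exact (mul_eq_zero.1 h2.symm).resolve_right (ZMod.choose_ne_zero (by omega) (by omega))

/-- Planar functions over a prime field are quadratic polynomials. -/
theorem IsPlanar.exists_quadratic {f : ZMod p → ZMod p} (hf : IsPlanar f) :
    ∃ α β γ : ZMod p, α ≠ 0 ∧ ∀ i, f i = α * i ^ 2 + β * i + γ := by
  have hp := (Fact.out : p.Prime)
  have h2p := hf.two_lt
  obtain ⟨F, hFd, hF⟩ := ZMod.exists_polynomial f
  have hodd : p % 2 = 1 := hp.eq_two_or_odd.resolve_left (by omega)
  have hD : F.natDegree ≤ 2 := by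
    by_contra! hD
    set D := F.natDegree with hDdef
    -- Division of p - 1 by D makes `X ^ s * F ^ r` of degree exactly p - 1, so the sum of its
    -- values is minus its leading coefficient, a nonzero moment.
    set r := (p - 1) / D with hr
    set s := (p - 1) % D with hs
    have hrs : D * r + s = p - 1 := Nat.div_add_mod (p - 1) D
    have hsD : s < D := Nat.mod_lt _ (by omega)
    have hr1 : 1 ≤ r := (Nat.one_le_div_iff (by omega)).2 hFd
    have hF0 : F ≠ 0 := by
      rintro h
      rw [hDdef, h, natDegree_zero] at hD
      omega
    have hdeg : (X ^ s * F ^ r).natDegree = p - 1 := by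
      rw [natDegree_mul (pow_ne_zero _ X_ne_zero) (pow_ne_zero _ hF0), natDegree_pow,
        natDegree_pow, natDegree_X, ← hDdef, ← hrs]
      ring
    have hne : ∑ x : ZMod p, x ^ s * f x ^ r ≠ 0 := by
      have h1 := ZMod.sum_eval_eq (X ^ s * F ^ r) hdeg.le
      simp only [eval_mul, eval_pow, eval_X, hF] at h1
      rw [h1, neg_ne_zero, ← hdeg, coeff_natDegree, leadingCoeff_ne_zero]
      exact mul_ne_zero (pow_ne_zero _ X_ne_zero) (pow_ne_zero _ hF0)
    rcases lt_or_ge (2 * (r + s)) (p - 1) with hlt | hge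
    · exact hne (hf.moment_eq_zero hlt)
    · obtain ⟨h, hh⟩ : ∃ h, 2 * h = p - 1 := ⟨(p - 1) / 2, by omega⟩
      -- Here D r + s ≤ 2 (r + s), so (D - 2) r ≤ s < D. With r ≥ 2 this leaves only D = 3, r = s =
      -- 2, that is p = 9, not a prime.
      have hr_eq : r = 1 := by
        by_contra hr'
        have hr2 : 2 ≤ r := by omega
        rcases Nat.lt_or_ge 3 D with h4 | h3
        · obtain ⟨D', hD'⟩ : ∃ D', D = D' + 2 := ⟨D - 2, by omega⟩
          obtain ⟨r', hr'⟩ : ∃ r', r = r' + 2 := ⟨r - 2, by omega⟩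
          rw [hD', hr'] at hrs
          have h5 : 0 ≤ r' * (D' - 2) := Nat.zero_le _
          nlinarith [Nat.zero_le (r' * D')]
        · have hD3 : D = 3 := by omega
          rw [hD3] at hrs hsD
          have : p = 9 := by omega
          rw [this] at hp
          exact absurd hp (by norm_num)
      rw [hr_eq] at hrs hge hne
      -- With r = 1 and p odd, s = D - 2 > 0 and r + s is exactly (p - 1) / 2.
      refine hne (hf.middle_moment_eq_zero hh (by omega) ?_)
      omega
  have hq : ∀ i, f i = F.coeff 2 * i ^ 2 + F.coeff 1 * i + F.coeff 0 := by
    intro i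
    rw [← hF, eval_eq_sum_range' (show F.natDegree < 3 by omega)]
    simp only [Finset.sum_range_succ, Finset.sum_range_zero]
    ring
  refine ⟨F.coeff 2, F.coeff 1, F.coeff 0, fun h => ?_, hq⟩
  have := (hf 1 one_ne_zero).injective (a₁ := 0) (a₂ := 1) (by simp only [hq, h]; ring)
  exact zero_ne_one this

end PlanarFunctions

namespace SRing

/-! ### Restriction to subgroups and transport of cosets -/

section Restriction

variable {G H : Type*} [Group G] [Finite G] [Group H] [Finite H]

theorem mem_restrict_basicSets {A : SRing G} {U : Subgroup G} {hU : A.IsASubgroup U}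
    {Y : Set U} : Y ∈ (A.restrict U hU).basicSets ↔ ((↑) '' Y : Set G) ∈ A.basicSets :=
  Iff.rfl

theorem preimage_mem_restrict {A : SRing G} {U : Subgroup G} (hU : A.IsASubgroup U) {X : Set G}
    (hX : X ∈ A.basicSets) {x : G} (hx : x ∈ X) (hxU : x ∈ U) :
    ((↑) ⁻¹' X : Set U) ∈ (A.restrict U hU).basicSets := by
  rw [mem_restrict_basicSets, Set.image_preimage_eq_inter_range, Subtype.range_val,
    Set.inter_eq_left.2 (hU.subset hX hx hxU)]
  exact hX

/-- An embedding of a model that sends its basic sets to basic sets makes the image an `A`-subgroup;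
this is how `U₁` and `U₂` are produced. -/
theorem exists_restrict_isomorphic {A : SRing G} {B : SRing H} (ι : H →* G)
    (hι : Function.Injective ι) (h : ∀ Y ∈ B.basicSets, ι '' Y ∈ A.basicSets) :
    ∃ hU : A.IsASubgroup ι.range, (A.restrict ι.range hU).Isomorphic B := by
  have key : ∀ X ∈ A.basicSets, ∀ y : H, ι y ∈ X → ∃ Y ∈ B.basicSets, ι '' Y = X := by
    intro X hX y hy
    obtain ⟨Y, hY, hyY⟩ := B.exists_basicSet y
    exact ⟨Y, hY, A.basicSet_unique (h Y hY) hX ⟨y, hyY, rfl⟩ hy⟩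
  have hU : A.IsASubgroup ι.range := by
    rw [isASubgroup_iff]
    rintro X hX _ hx ⟨y, rfl⟩
    obtain ⟨Y, -, rfl⟩ := key X hX y hx
    rintro _ ⟨z, -, rfl⟩
    exact ⟨z, rfl⟩
  refine ⟨hU, Isomorphic.of_mulEquiv (MonoidHom.ofInjective hι).symm fun X hX => ?_⟩
  obtain ⟨⟨_, y, rfl⟩, hx⟩ := (A.restrict _ hU).basicSet_nonempty hX
  obtain ⟨Y, hY, hYX⟩ := key _ (mem_restrict_basicSets.1 hX) y ⟨_, hx, rfl⟩
  suffices (MonoidHom.ofInjective hι).symm '' X = Y by rwa [this]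
  ext t
  have h0 : t ∈ (MonoidHom.ofInjective hι).symm '' X ↔ MonoidHom.ofInjective hι t ∈ X := by
    constructor
    · rintro ⟨s, hs, rfl⟩
      rwa [MulEquiv.apply_symm_apply]
    · intro ht
      exact ⟨_, ht, MulEquiv.symm_apply_apply _ _⟩
  have h1 : (MonoidHom.ofInjective hι t) ∈ X ↔ ι t ∈ ((↑) '' X : Set G) := by
    constructor
    · intro ht
      exact ⟨_, ht, rfl⟩
    · rintro ⟨s, hs, hst⟩
      rwa [show MonoidHom.ofInjective hι t = s from Subtype.ext hst.symm]
  rw [h0, h1, ← hYX, hι.mem_set_image]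

theorem mem_comapSubgroup {A : SRing G} {B : SRing H} {f : G ≃ H} {hf1 : f 1 = 1}
    {hf : ∀ X ∈ A.basicSets, f '' X ∈ B.basicSets ∧
      ∀ g h : G, h * g⁻¹ ∈ X ↔ f h * (f g)⁻¹ ∈ f '' X}
    {K : Subgroup H} {hK : B.IsASubgroup K} {g : G} :
    g ∈ comapSubgroup hf1 hf hK ↔ f g ∈ K :=
  Iff.rfl

theorem card_comapSubgroup {A : SRing G} {B : SRing H} {f : G ≃ H} (hf1 : f 1 = 1)
    (hf : ∀ X ∈ A.basicSets, f '' X ∈ B.basicSets ∧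
      ∀ g h : G, h * g⁻¹ ∈ X ↔ f h * (f g)⁻¹ ∈ f '' X)
    {K : Subgroup H} (hK : B.IsASubgroup K) :
    Nat.card (comapSubgroup hf1 hf hK) = Nat.card K :=
  Nat.card_congr (f.subtypeEquiv fun _ => Iff.rfl)

/-- If the basic sets meeting a part of `H` are cosets of a `B`-subgroup, then the corresponding
basic sets of an isomorphic S-ring are cosets of the corresponding subgroup. -/
theorem mem_iff_of_coset {A : SRing G} {B : SRing H} {f : G ≃ H} (hf1 : f 1 = 1)
    (hf : ∀ X ∈ A.basicSets, f '' X ∈ B.basicSets ∧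
      ∀ g h : G, h * g⁻¹ ∈ X ↔ f h * (f g)⁻¹ ∈ f '' X)
    {K : Subgroup H} (hK : B.IsASubgroup K) {X : Set G} {x : G}
    (hc : ∀ t, t ∈ f '' X ↔ t * (f x)⁻¹ ∈ K) (y : G) :
    y ∈ X ↔ y * x⁻¹ ∈ comapSubgroup hf1 hf hK := by
  rw [mem_comapSubgroup, preimage_mul_inv_mem_iff hf hK, ← hc, f.injective.mem_set_image]

end Restriction

/-! ### The wreath product models -/

section WreathModels

variable {p : ℕ} [Fact p.Prime]

theorem card_Cp : Nat.card (Cp p) = p := by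
  change Nat.card (ZMod p) = p
  exact Nat.card_zmod p

theorem isASubgroup_prod_bot {H K : Type*} [Group H] [Finite H] [Group K] [Finite K]
    (A : SRing H) (B : SRing K) {M : Subgroup K} (hM : B.IsASubgroup M) :
    (A.wreath B).IsASubgroup ((⊤ : Subgroup H).prod M) := by
  rw [isASubgroup_iff]
  rintro W (⟨X, hX, rfl⟩ | ⟨Y, hY, -, rfl⟩) ⟨a, b⟩ hab hm ⟨c, d⟩ hcd
  · rw [Set.mem_prod, Set.mem_singleton_iff] at hab hcd
    exact ⟨trivial, by
      rw [show d = 1 from hcd.2]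
      exact M.one_mem⟩
  · exact ⟨trivial, hM.subset hY hab.2 hm.2 hcd.2⟩

theorem isASubgroup_bot {G : Type*} [Group G] [Finite G] (A : SRing G) : A.IsASubgroup ⊥ := by
  rw [isASubgroup_iff]
  intro X hX x hx hx1
  rw [Subgroup.mem_bot] at hx1
  subst hx1
  rw [A.basicSet_unique hX A.singleton_one_mem hx rfl]
  simp

theorem basicSet_wreath_groupRing {H K : Type*} [Group H] [Finite H] [Group K] [Finite K]
    (B : SRing K) {W : Set (H × K)} (hW : W ∈ ((groupRing H).wreath B).basicSets) {y : H × K}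
    (hy : y ∈ W) :
    (y.2 = 1 → W = {y}) ∧ (y.2 ≠ 1 → ∃ Y ∈ B.basicSets, y.2 ∈ Y ∧ W = Set.univ ×ˢ Y) := by
  obtain ⟨X, ⟨g, rfl⟩, rfl⟩ | ⟨Y, hY, hne, rfl⟩ := hW
  · obtain ⟨h1, h2⟩ := hy
    obtain ⟨a, b⟩ := y
    obtain rfl : a = g := h1
    obtain rfl : b = 1 := h2
    simp
  · refine ⟨fun h => ?_, fun _ => ⟨Y, hY, hy.2, rfl⟩⟩
    have : (1 : K) ∈ Y := h ▸ hy.2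
    exact absurd (B.basicSet_unique hY B.singleton_one_mem this rfl) hne

theorem basicSet_groupRing {K : Type*} [Group K] [Finite K] {Y : Set K}
    (hY : Y ∈ (groupRing K).basicSets) {y : K} (hy : y ∈ Y) : Y = {y} := by
  obtain ⟨g, rfl⟩ := hY
  rw [Set.mem_singleton_iff.1 hy]

/-- L is the preimage of the first factor `Cp p`. Combinatorial isomorphisms preserve its cosets, so
the shape of the basic sets survives although the map is not a homomorphism. -/
theorem exists_subgroup_of_isomorphic_wreathCpCp2 {G : Type*} [Group G] [Finite G] {B : SRing G}
    (h : B.Isomorphic (wreathCpCp2 p)) :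
    ∃ L : Subgroup G, Nat.card L = p ∧ (∀ X ∈ B.basicSets, ∀ x ∈ X, x ∈ L → X = {x}) ∧
      ∀ X ∈ B.basicSets, ∀ x ∈ X, x ∉ L → ∀ y, y ∈ X ↔ y * x⁻¹ ∈ L := by
  obtain ⟨f, hf1, hf⟩ := h.exists_normalized
  have hK : (wreathCpCp2 p).IsASubgroup ((⊤ : Subgroup (Cp p)).prod ⊥) :=
    isASubgroup_prod_bot _ _ (isASubgroup_bot _)
  refine ⟨comapSubgroup hf1 hf hK, ?_, fun X hX x hx hxL => ?_, fun X hX x hx hxL => ?_⟩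
  · rw [card_comapSubgroup, Nat.card_congr (Subgroup.prodEquiv _ _).toEquiv, Nat.card_prod]
    simp
  · have h1 := (basicSet_wreath_groupRing _ (hf X hX).1 (y := f x) ⟨x, hx, rfl⟩).1 hxL.2
    rw [← Set.image_singleton] at h1
    exact f.injective.image_injective h1
  · refine mem_iff_of_coset hf1 hf hK fun t => ?_
    have hx2 : (f x).2 ≠ 1 := fun h2 => hxL ⟨trivial, h2⟩
    obtain ⟨Y, hY, hxY, hXY⟩ :=
      (basicSet_wreath_groupRing _ (hf X hX).1 (y := f x) ⟨x, hx, rfl⟩).2 hx2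
    rw [hXY, basicSet_groupRing hY hxY, Subgroup.mem_prod]
    simp [mul_inv_eq_one]

theorem exists_flag_of_isomorphic_wreathCpCpCp {G : Type*} [Group G] [Finite G] {B : SRing G}
    (h : B.Isomorphic (wreathCpCpCp p)) :
    ∃ L V : Subgroup G, L ≤ V ∧ Nat.card L = p ∧ Nat.card V = p ^ 2 ∧ Nat.card G = p ^ 3 ∧
      (∀ X ∈ B.basicSets, ∀ x ∈ X, x ∈ L → X = {x}) ∧
      (∀ X ∈ B.basicSets, ∀ x ∈ X, x ∉ L → x ∈ V → ∀ y, y ∈ X ↔ y * x⁻¹ ∈ L) ∧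
      (∀ X ∈ B.basicSets, ∀ x ∈ X, x ∉ V → ∀ y, y ∈ X ↔ y * x⁻¹ ∈ V) := by
  obtain ⟨f, hf1, hf⟩ := h.exists_normalized
  have hK : (wreathCpCpCp p).IsASubgroup ((⊤ : Subgroup (Cp p)).prod ⊥) :=
    isASubgroup_prod_bot _ _ (isASubgroup_bot _)
  have hK2 : (wreathCpCpCp p).IsASubgroup
      ((⊤ : Subgroup (Cp p)).prod ((⊤ : Subgroup (Cp p)).prod ⊥)) :=
    isASubgroup_prod_bot _ _ (isASubgroup_prod_bot _ _ (isASubgroup_bot _))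
  refine ⟨comapSubgroup hf1 hf hK, comapSubgroup hf1 hf hK2, fun x hx => ?_, ?_, ?_, ?_,
    fun X hX x hx hxL => ?_, fun X hX x hx hxL hxV => ?_, fun X hX x hx hxV => ?_⟩
  · refine ⟨trivial, trivial, ?_⟩
    have h2 : (f x).2 = 1 := hx.2
    simp [h2]
  · rw [card_comapSubgroup, Nat.card_congr (Subgroup.prodEquiv _ _).toEquiv, Nat.card_prod]
    simp
  · rw [card_comapSubgroup, Nat.card_congr (Subgroup.prodEquiv _ _).toEquiv, Nat.card_prod,
      Nat.card_congr (Subgroup.prodEquiv _ _).toEquiv, Nat.card_prod]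
    simp [sq]
  · rw [Nat.card_congr f, Nat.card_prod, Nat.card_prod, card_Cp]
    ring
  · have h1 := (basicSet_wreath_groupRing _ (hf X hX).1 (y := f x) ⟨x, hx, rfl⟩).1 hxL.2
    rw [← Set.image_singleton] at h1
    exact f.injective.image_injective h1
  · refine mem_iff_of_coset hf1 hf hK fun t => ?_
    have hx2 : (f x).2 ≠ 1 := fun h2 => hxL ⟨trivial, h2⟩
    obtain ⟨Y, hY, hxY, hXY⟩ :=
      (basicSet_wreath_groupRing _ (hf X hX).1 (y := f x) ⟨x, hx, rfl⟩).2 hx2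
    rw [hXY, (basicSet_wreath_groupRing _ hY hxY).1 hxV.2.2, Subgroup.mem_prod]
    simp [mul_inv_eq_one]
  · refine mem_iff_of_coset hf1 hf hK2 fun t => ?_
    have hx3 : (f x).2.2 ≠ 1 := fun h2 => hxV ⟨trivial, trivial, h2⟩
    have hx2 : (f x).2 ≠ 1 := fun h2 => hx3 (by rw [h2]; rfl)
    obtain ⟨Y, hY, hxY, hXY⟩ :=
      (basicSet_wreath_groupRing _ (hf X hX).1 (y := f x) ⟨x, hx, rfl⟩).2 hx2
    obtain ⟨Y', hY', hxY', hYY'⟩ := (basicSet_wreath_groupRing _ hY hxY).2 hx3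
    rw [hXY, hYY', basicSet_groupRing hY' hxY', Subgroup.mem_prod, Subgroup.mem_prod]
    simp [mul_inv_eq_one]

end WreathModels

/-! ### The model `Dp` -/

section DpModel

variable (p : ℕ) [Fact p.Prime]

theorem sigmaAut_apply (v : Multiplicative (Fin 3 → ZMod p)) :
    (sigmaAut p v).toAdd = ![v.toAdd 0 + v.toAdd 1, v.toAdd 1 + v.toAdd 2, v.toAdd 2] := by
  have : (sigmaAut p v).toAdd = (sigma p).1.mulVec v.toAdd := rfl
  rw [this]
  ext i
  fin_cases i <;> simp [sigma, Matrix.mulVec, dotProduct, Fin.sum_univ_three]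

theorem mem_orbit_sigmaAut {v w : Multiplicative (Fin 3 → ZMod p)} :
    w ∈ MulAction.orbit (Subgroup.zpowers (sigmaAut p)) v ↔ ∃ n : ℕ, (sigmaAut p ^ n) v = w := by
  constructor
  · rintro ⟨⟨m, hm⟩, rfl⟩
    have : Finite (MulAut (Multiplicative (Fin 3 → ZMod p))) :=
      Finite.of_injective (fun φ : MulAut _ => (φ : _ → _)) DFunLike.coe_injective
    obtain ⟨n, rfl⟩ := mem_powers_iff_mem_zpowers.2 hm
    exact ⟨n, rfl⟩
  · rintro ⟨n, rfl⟩
    exact ⟨⟨sigmaAut p ^ n, Subgroup.npow_mem_zpowers _ n⟩, rfl⟩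

theorem sigmaAut_pow_apply (h2 : (2 : ZMod p) ≠ 0) (n : ℕ)
    (v : Multiplicative (Fin 3 → ZMod p)) :
    ((sigmaAut p ^ n) v).toAdd =
      ![v.toAdd 0 + n * v.toAdd 1 + n * (n - 1) / 2 * v.toAdd 2, v.toAdd 1 + n * v.toAdd 2,
        v.toAdd 2] := by
  induction n with
  | zero => ext i; fin_cases i <;> simp
  | succ n ih =>
    rw [pow_succ', MulAut.mul_apply, sigmaAut_apply, ih]
    ext i
    fin_cases i
    · simp
      field_simp
      ring
    · simp
      ring
    · simp

/-- For odd p the entry p (p - 1) / 2 of the p-th power of σ vanishes modulo p, so σ has order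
dividing p. -/
theorem ncard_basicSet_Dp_le (hp : 2 < p) {X : Set (Multiplicative (Fin 3 → ZMod p))}
    (hX : X ∈ (Dp p).basicSets) : X.ncard ≤ p := by
  obtain ⟨v, rfl⟩ := hX
  have h2 : (2 : ZMod p) ≠ 0 := by
    have := (ZMod.natCast_eq_zero_iff 2 p).not.2 (fun h => by
      have := Nat.le_of_dvd (by norm_num) h
      omega)
    simpa using this
  have hsp : sigmaAut p ^ p = 1 := by
    ext w : 1
    apply Multiplicative.toAdd.injective
    rw [sigmaAut_pow_apply p h2]
    ext i
    fin_cases i <;> simp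
  have hle : MulAction.orbit (Subgroup.zpowers (sigmaAut p)) v ⊆
      (fun n : ℕ => (sigmaAut p ^ n) v) '' (Finset.range p : Set ℕ) := by
    intro w hw
    obtain ⟨n, rfl⟩ := (mem_orbit_sigmaAut p).1 hw
    refine ⟨n % p, ?_, ?_⟩
    · simpa using Nat.mod_lt n (by omega)
    · simp only
      rw [← pow_eq_pow_mod n hsp]
  refine (Set.ncard_le_ncard hle (Set.toFinite _)).trans ((Set.ncard_image_le).trans ?_)
  rw [Set.ncard_coe_finset, Finset.card_range]

/-- This separates `Dp` from S-rings whose basic sets lie in cosets of a subgroup of one-point basic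
sets. In the model, (0,0,1) and its image (0,1,1) differ by (0,1,0), which σ moves. -/
theorem exists_of_isomorphic_Dp {G : Type*} [Group G] [Finite G] {B : SRing G}
    (h : B.Isomorphic (Dp p)) :
    ∃ X ∈ B.basicSets, ∃ y ∈ X, ∃ y' ∈ X, {y' * y⁻¹} ∉ B.basicSets := by
  obtain ⟨f, hf1, hf⟩ := h.exists_normalized
  set v : Multiplicative (Fin 3 → ZMod p) := Multiplicative.ofAdd ![0, 0, 1] with hv
  set v' : Multiplicative (Fin 3 → ZMod p) := Multiplicative.ofAdd ![0, 1, 1] with hv'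
  have hvv' : sigmaAut p v = v' := by
    apply Multiplicative.toAdd.injective
    rw [sigmaAut_apply]
    ext i
    fin_cases i <;> simp [hv, hv']
  obtain ⟨X, hX, hx⟩ := B.exists_basicSet (f.symm v)
  have hO : MulAction.orbit (Subgroup.zpowers (sigmaAut p)) v ∈ (Dp p).basicSets := ⟨v, rfl⟩
  have hXO := (Dp p).basicSet_unique (hf X hX).1 hO ⟨_, hx, f.apply_symm_apply v⟩
    (MulAction.mem_orbit_self v)
  have hv'X : v' ∈ f '' X := by
    rw [hXO, mem_orbit_sigmaAut]
    exact ⟨1, by rw [pow_one, hvv']⟩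
  obtain ⟨y', hy', hyv'⟩ := hv'X
  refine ⟨X, hX, f.symm v, hx, y', hy', fun hs => ?_⟩
  have h1 := ((hf _ hs).2 (f.symm v) y').1 rfl
  have h2 := (hf _ hs).1
  rw [Set.image_singleton] at h1 h2
  rw [← Set.mem_singleton_iff.1 h1, f.apply_symm_apply, hyv'] at h2
  obtain ⟨t, ht⟩ := h2
  have h3 : v' * v⁻¹ ∈ MulAction.orbit (Subgroup.zpowers (sigmaAut p)) t := by
    have : MulAction.orbit (Subgroup.zpowers (sigmaAut p)) t = {v' * v⁻¹} := ht
    rw [this]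
    rfl
  have h4 : sigmaAut p (v' * v⁻¹) ∈ MulAction.orbit (Subgroup.zpowers (sigmaAut p)) t := by
    obtain ⟨n, hn⟩ := (mem_orbit_sigmaAut p).1 h3
    rw [mem_orbit_sigmaAut]
    exact ⟨n + 1, by rw [pow_succ', MulAut.mul_apply, hn]⟩
  have h5 : sigmaAut p (v' * v⁻¹) = v' * v⁻¹ := by
    have : MulAction.orbit (Subgroup.zpowers (sigmaAut p)) t = {v' * v⁻¹} := ht
    rwa [this] at h4
  have h6 := congrArg (fun w : Multiplicative (Fin 3 → ZMod p) => w.toAdd 0) h5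
  simp only [sigmaAut_apply] at h6
  simp [hv, hv'] at h6

end DpModel

end SRing

namespace SRing

/-! ### The flag in U and the complement W -/

section Flag

variable {G : Type*} [CommGroup G] [Finite G]

/-- The `A`-subgroups `L < V < U` of orders `p`, `p ^ 2`, `p ^ 3` display `A_U` as the iterated
wreath product: the basic sets of `A` in `L`, `V \ L`, `U \ V` are the singletons, the `L`-cosets
and the `V`-cosets. -/
structure IsWreathFlag (A : SRing G) (p : ℕ) (U V L : Subgroup G) : Prop where
  le_V : L ≤ V
  le_U : V ≤ U
  card_L : Nat.card L = p
  card_V : Nat.card V = p ^ 2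
  card_U : Nat.card U = p ^ 3
  isASubgroup_U : A.IsASubgroup U
  singleton : ∀ X ∈ A.basicSets, ∀ x ∈ X, x ∈ L → X = {x}
  coset_L : ∀ X ∈ A.basicSets, ∀ x ∈ X, x ∉ L → x ∈ V → ∀ y, y ∈ X ↔ y * x⁻¹ ∈ L
  coset_V : ∀ X ∈ A.basicSets, ∀ x ∈ X, x ∈ U → x ∉ V → ∀ y, y ∈ X ↔ y * x⁻¹ ∈ V

theorem exists_isWreathFlag {A : SRing G} {p : ℕ} [Fact p.Prime] {U : Subgroup G}
    (hU : A.IsASubgroup U) (hiso : (A.restrict U hU).Isomorphic (wreathCpCpCp p)) :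
    ∃ V L : Subgroup G, A.IsWreathFlag p U V L := by
  obtain ⟨L, V, hLV, hL, hV, hU3, h1, h2, h3⟩ := exists_flag_of_isomorphic_wreathCpCpCp hiso
  have hmem : ∀ (K : Subgroup U) (u : U), (u : G) ∈ K.map U.subtype ↔ u ∈ K := fun K u =>
    Subgroup.mem_map_iff_mem U.subtype_injective
  have hcard : ∀ K : Subgroup U, Nat.card (K.map U.subtype) = Nat.card K := fun K =>
    (Nat.card_congr (K.equivMapOfInjective _ U.subtype_injective).toEquiv).symm
  have hle : ∀ K : Subgroup U, K.map U.subtype ≤ U := fun K => Subgroup.map_subtype_le K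
  have hco : ∀ (K : Subgroup U) (X : Set G), X ⊆ (U : Set G) → ∀ x : U,
      (∀ y : U, y ∈ ((↑) ⁻¹' X : Set U) ↔ y * x⁻¹ ∈ K) →
      ∀ y : G, y ∈ X ↔ y * (x : G)⁻¹ ∈ K.map U.subtype := by
    intro K X hXU x h y
    constructor
    · intro hy
      exact (hmem K (⟨y, hXU hy⟩ * x⁻¹)).2 ((h ⟨y, hXU hy⟩).1 hy)
    · intro hy
      have hyU : y ∈ U := by
        have := mul_mem (hle K hy) x.2
        rwa [inv_mul_cancel_right] at this
      exact (h ⟨y, hyU⟩).2 ((hmem K (⟨y, hyU⟩ * x⁻¹)).1 hy)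
  refine ⟨V.map U.subtype, L.map U.subtype, Subgroup.map_mono hLV, hle V, by rw [hcard, hL],
    by rw [hcard, hV], hU3, hU, fun X hX x hx hxL => ?_, fun X hX x hx hxL hxV => ?_,
    fun X hX x hx hxU hxV => ?_⟩
  · have hxU := hle L hxL
    have h := h1 _ (preimage_mem_restrict hU hX hx hxU) ⟨x, hxU⟩ hx ((hmem L ⟨x, hxU⟩).1 hxL)
    ext y
    constructor
    · intro hy
      have : (⟨y, hU.subset hX hx hxU hy⟩ : U) ∈ ((↑) ⁻¹' X : Set U) := hy
      rw [h] at this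
      exact congrArg Subtype.val (Set.mem_singleton_iff.1 this)
    · rintro rfl
      exact hx
  · have hxU := hle V hxV
    exact hco L X (hU.subset hX hx hxU) ⟨x, hxU⟩ (h2 _ (preimage_mem_restrict hU hX hx hxU)
      ⟨x, hxU⟩ hx (fun h => hxL ((hmem L ⟨x, hxU⟩).2 h)) ((hmem V ⟨x, hxU⟩).1 hxV))
  · exact hco V X (hU.subset hX hx hxU) ⟨x, hxU⟩ (h3 _ (preimage_mem_restrict hU hX hx hxU)
      ⟨x, hxU⟩ hx (fun h => hxV ((hmem V ⟨x, hxU⟩).2 h)))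

theorem eq_of_le_of_lt_card {p : ℕ} (hp : p.Prime) {n : ℕ} {H K : Subgroup G} (hHK : H ≤ K)
    (hK : Nat.card K = p ^ (n + 1)) (hH : p ^ n < Nat.card H) : H = K := by
  refine Subgroup.eq_of_le_of_card_ge hHK ?_
  obtain ⟨m, hm, h⟩ := (Nat.dvd_prime_pow hp).1 (hK ▸ Subgroup.card_dvd_of_le hHK)
  rw [h] at hH
  have := (Nat.pow_lt_pow_iff_right hp.one_lt).1 hH
  rw [hK, h, show m = n + 1 by omega]

theorem card_lt_of_mem_of_notMem {H K : Subgroup G} (hHK : H ≤ K) {g : G} (hg : g ∈ K)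
    (hgH : g ∉ H) : Nat.card H < Nat.card K := by
  refine lt_of_le_of_ne (Nat.card_mono (Set.toFinite _) hHK) fun h => hgH ?_
  rwa [Subgroup.eq_of_le_of_card_ge hHK h.ge]

namespace IsWreathFlag

variable {A : SRing G} {p : ℕ} {U V L : Subgroup G}

theorem isASubgroup_V (h : A.IsWreathFlag p U V L) : A.IsASubgroup V := by
  rw [isASubgroup_iff]
  intro X hX x hx hxV y hy
  by_cases hxL : x ∈ L
  · rw [h.singleton X hX x hx hxL] at hy
    rwa [Set.mem_singleton_iff.1 hy]
  · have := mul_mem (h.le_V ((h.coset_L X hX x hx hxL hxV y).1 hy)) hxV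
    rwa [inv_mul_cancel_right] at this

theorem isASubgroup_L (h : A.IsWreathFlag p U V L) : A.IsASubgroup L := by
  rw [isASubgroup_iff]
  intro X hX x hx hxL y hy
  rw [h.singleton X hX x hx hxL] at hy
  rwa [Set.mem_singleton_iff.1 hy]

/-- The basic set of g is the coset `V g`, and quotients of its elements fill V. -/
theorem V_le_of_mem (h : A.IsWreathFlag p U V L) {K : Subgroup G} (hK : A.IsASubgroup K) {g : G}
    (hgK : g ∈ K) (hgU : g ∈ U) (hgV : g ∉ V) : V ≤ K := by
  intro v hv
  obtain ⟨X, hX, hgX⟩ := A.exists_basicSet g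
  have h1 : v * g ∈ X := (h.coset_V X hX g hgX hgU hgV _).2 (by simpa using hv)
  have := mul_mem (hK.subset hX hgX hgK h1) (K.inv_mem hgK)
  rwa [mul_inv_cancel_right] at this

theorem L_le_of_mem (h : A.IsWreathFlag p U V L) {K : Subgroup G} (hK : A.IsASubgroup K) {g : G}
    (hgK : g ∈ K) (hgV : g ∈ V) (hgL : g ∉ L) : L ≤ K := by
  intro v hv
  obtain ⟨X, hX, hgX⟩ := A.exists_basicSet g
  have h1 : v * g ∈ X := (h.coset_L X hX g hgX hgL hgV _).2 (by simpa using hv)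
  have := mul_mem (hK.subset hX hgX hgK h1) (K.inv_mem hgK)
  rwa [mul_inv_cancel_right] at this

/-- V has index p in U, so V and one further element of U generate U. -/
theorem U_le_of_mem (h : A.IsWreathFlag p U V L) (hp : p.Prime) {K : Subgroup G}
    (hK : A.IsASubgroup K) {g : G} (hgK : g ∈ K) (hgU : g ∈ U) (hgV : g ∉ V) : U ≤ K := by
  have h1 : V ≤ K ⊓ U := le_inf (h.V_le_of_mem hK hgK hgU hgV) h.le_U
  have h2 : K ⊓ U = U := eq_of_le_of_lt_card hp inf_le_right h.card_U
    (h.card_V ▸ card_lt_of_mem_of_notMem h1 ⟨hgK, hgU⟩ hgV)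
  exact inf_eq_right.1 h2

/-- `V` is the only `A`-subgroup of order `p ^ 2` in `U`. -/
theorem eq_V (h : A.IsWreathFlag p U V L) (hp : p.Prime) {K : Subgroup G} (hK : A.IsASubgroup K)
    (hcard : Nat.card K = p ^ 2) (hKU : K ≤ U) : K = V := by
  refine Subgroup.eq_of_le_of_card_ge (fun g hg => ?_) (by rw [hcard, h.card_V])
  by_contra hgV
  have := Nat.card_mono (Set.toFinite _) (h.U_le_of_mem hp hK hg (hKU hg) hgV)
  have h2 : Nat.card U ≤ Nat.card K := this
  rw [hcard, h.card_U] at h2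
  exact absurd ((Nat.pow_le_pow_iff_right hp.one_lt).1 h2) (by norm_num)

theorem L_le_of_ne_bot (h : A.IsWreathFlag p U V L) (hp : p.Prime) {K : Subgroup G}
    (hK : A.IsASubgroup K) (hKV : K ≤ V) (hne : K ≠ ⊥) : L ≤ K := by
  obtain ⟨⟨k, hk⟩, hk0⟩ := Subgroup.ne_bot_iff_exists_ne_one.1 hne
  have hk1 : k ≠ 1 := fun h => hk0 (Subtype.ext h)
  by_cases hkL : k ∈ L
  · have h1 : K ⊓ L = L := by
      refine eq_of_le_of_lt_card (n := 0) hp inf_le_right (by rw [h.card_L]; ring) ?_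
      have := card_lt_of_mem_of_notMem (H := ⊥) bot_le (show k ∈ K ⊓ L from ⟨hk, hkL⟩)
        (by simpa using hk1)
      simpa using this
    exact inf_eq_right.1 h1
  · exact h.L_le_of_mem hK hk (hKV hk) hkL

/-- In a decomposable S-ring with a basic set of trivial radical outside `U`, there is a second
`A`-subgroup `W` of index `p` with `W ∩ U = V` outside which all basic sets are `L`-invariant. -/
theorem exists_complement (h : A.IsWreathFlag p U V L) (hp : p.Prime)
    (hcard : Nat.card G = p ^ 4) (hdec : A.IsDecomposable)
    (hrad : ∃ X ∈ A.basicSets, X ⊆ (U : Set G)ᶜ ∧ setRadical X = {1}) :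
    ∃ W : Subgroup G, A.IsASubgroup W ∧ W ⊓ U = V ∧
      (∃ X ∈ A.basicSets, X ⊆ (U : Set G)ᶜ ∧ X ⊆ (W : Set G) ∧ setRadical X = {1}) ∧
      ∀ X ∈ A.basicSets, ∀ x ∈ X, x ∉ W → ∀ l ∈ L, l * x ∈ X := by
  obtain ⟨U₀, L₀, hU₀, hL₀, hLU, -, hinv, hLne, hUne⟩ := hdec
  obtain ⟨X, hX, hXU, hXr⟩ := hrad
  have hout : ∀ Y ∈ A.basicSets, ∀ y ∈ Y, y ∉ U₀ → ∀ l ∈ L₀, l • Y = Y := by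
    intro Y hY y hy hyU l hl
    have h1 : Y ⊆ (U₀ : Set G)ᶜ := fun z hz hzU => hyU (hU₀.subset hY hz hzU hy)
    exact (hinv Y hY h1 hl).1
  -- Outside U₀ the radical of X would contain the nontrivial L₀.
  have hXU₀ : X ⊆ (U₀ : Set G) := by
    intro x hx
    by_contra hxU
    have h1 : X ⊆ (U₀ : Set G)ᶜ := fun z hz hzU => hxU (hU₀.subset hX hz hzU hx)
    refine hLne ((Subgroup.eq_bot_iff_forall _).2 fun l hl => ?_)
    have := hinv X hX h1 hl
    rw [hXr] at this
    exact this
  obtain ⟨x, hx⟩ := A.basicSet_nonempty hX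
  -- Otherwise U₀ contains U and also X, which lies outside U, so it is all of G.
  have hinf : U₀ ⊓ U ≤ V := by
    intro g hg
    by_contra hgV
    have hUU₀ := h.U_le_of_mem hp hU₀ hg.1 hg.2 hgV
    refine hUne (eq_of_le_of_lt_card (n := 3) hp le_top (by rw [Subgroup.card_top, hcard]) ?_)
    rw [← h.card_U]
    exact card_lt_of_mem_of_notMem hUU₀ (hXU₀ hx) (hXU hx)
  obtain ⟨u, huU, huV⟩ : ∃ u ∈ U, u ∉ V := by
    by_contra! hc
    have := Nat.card_mono (Set.toFinite _) (show U ≤ V from hc)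
    have h2 : Nat.card U ≤ Nat.card V := this
    rw [h.card_U, h.card_V] at h2
    exact absurd ((Nat.pow_le_pow_iff_right hp.one_lt).1 h2) (by norm_num)
  have huU₀ : u ∉ U₀ := fun hu => huV (hinf ⟨hu, huU⟩)
  -- The basic set of u is a `V`-coset by the flag and `L₀`-invariant by decomposability.
  have hL₀V : L₀ ≤ V := by
    intro l hl
    obtain ⟨Y, hY, huY⟩ := A.exists_basicSet u
    have h1 : l * u ∈ Y := by
      rw [← hout Y hY u huY huU₀ l hl]
      exact Set.smul_mem_smul_set huY
    simpa using (h.coset_V Y hY u huY huU huV _).1 h1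
  have hLL₀ : L ≤ L₀ := h.L_le_of_ne_bot hp hL₀ hL₀V hLne
  refine ⟨U₀ ⊔ V, hU₀.sup h.isASubgroup_V, ?_, ⟨X, hX, hXU, ?_, hXr⟩, ?_⟩
  -- The modular law gives V (U₀ ∩ U), which is V.
  · rw [sup_comm, sup_inf_assoc_of_le U₀ h.le_U]
    exact sup_eq_left.2 hinf
  · exact hXU₀.trans (SetLike.coe_subset_coe.2 le_sup_left)
  · intro Y hY y hy hyW l hl
    rw [← hout Y hY y hy (fun hyU => hyW (Subgroup.mem_sup_left hyU)) l (hLL₀ hl)]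
    exact Set.smul_mem_smul_set hy

end IsWreathFlag

end Flag

/-! ### Coordinates on G -/

section Coordinates

variable {G : Type*} [CommGroup G] {p : ℕ} [Fact p.Prime]

theorem pow_val_add {g : G} (hg : g ^ p = 1) (a b : ZMod p) :
    g ^ (a + b).val = g ^ a.val * g ^ b.val := by
  rw [ZMod.val_add, ← pow_add, ← pow_eq_pow_mod _ hg]

theorem pow_val_mul {g : G} (hg : g ^ p = 1) (a b : ZMod p) :
    g ^ (a * b).val = (g ^ a.val) ^ b.val := by
  rw [ZMod.val_mul, ← pow_mul, ← pow_eq_pow_mod _ hg]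

theorem mem_of_pow_val_mem {g : G} (hg : g ^ p = 1) {H : Subgroup G} {a : ZMod p}
    (h : g ^ a.val ∈ H) (ha : a ≠ 0) : g ∈ H := by
  have h1 := H.pow_mem h (a⁻¹).val
  rwa [← pow_val_mul hg, mul_inv_cancel₀ ha, ZMod.val_one, pow_one] at h1

/-- Coordinates on a group of order `p ^ 4` and exponent `p` adapted to subgroups
`L < V = W ∩ U`. -/
structure IsCoordinates (E : ZMod p → ZMod p → ZMod p → ZMod p → G) (U W V L : Subgroup G) :
    Prop where
  mul : ∀ a b c d a' b' c' d', E a b c d * E a' b' c' d' = E (a + a') (b + b') (c + c') (d + d')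
  inj : ∀ {a b c d a' b' c' d'}, E a b c d = E a' b' c' d' → a = a' ∧ b = b' ∧ c = c' ∧ d = d'
  surj : ∀ g, ∃ a b c d, E a b c d = g
  mem_U : ∀ {a b c d}, E a b c d ∈ U ↔ a = 0
  mem_W : ∀ {a b c d}, E a b c d ∈ W ↔ b = 0
  mem_V : ∀ {a b c d}, E a b c d ∈ V ↔ a = 0 ∧ b = 0
  mem_L : ∀ {a b c d}, E a b c d ∈ L ↔ a = 0 ∧ b = 0 ∧ c = 0

theorem exists_isCoordinates [Finite G] (hexp : ∀ g : G, g ^ p = 1) (hcard : Nat.card G = p ^ 4)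
    {U W V L : Subgroup G} (hLV : L ≤ V) (hWU : W ⊓ U = V) (hL : L ≠ ⊥) {x u w : G}
    (hxW : x ∈ W) (hxU : x ∉ U) (huU : u ∈ U) (huV : u ∉ V) (hwV : w ∈ V) (hwL : w ∉ L) :
    ∃ E : ZMod p → ZMod p → ZMod p → ZMod p → G, IsCoordinates E U W V L ∧ E 1 0 0 0 = x := by
  obtain ⟨⟨z, hz⟩, hz0⟩ := Subgroup.ne_bot_iff_exists_ne_one.1 hL
  have hz1 : z ≠ 1 := fun h => hz0 (Subtype.ext h)
  have huW : u ∉ W := fun h => huV (hWU ▸ ⟨h, huU⟩)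
  have hVW : V ≤ W := hWU ▸ inf_le_left
  have hVU : V ≤ U := hWU ▸ inf_le_right
  set E : ZMod p → ZMod p → ZMod p → ZMod p → G := fun a b c d =>
    x ^ a.val * u ^ b.val * w ^ c.val * z ^ d.val with hE
  have hmul : ∀ a b c d a' b' c' d',
      E a b c d * E a' b' c' d' = E (a + a') (b + b') (c + c') (d + d') := by
    intro a b c d a' b' c' d'
    simp only [hE, pow_val_add (hexp _)]
    simp only [mul_assoc, mul_left_comm]
  have hmU : ∀ {a b c d}, E a b c d ∈ U ↔ a = 0 := by
    intro a b c d
    simp only [hE]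
    rw [mul_mem_cancel_right (U.pow_mem (hVU (hLV hz)) _),
      mul_mem_cancel_right (U.pow_mem (hVU hwV) _), mul_mem_cancel_right (U.pow_mem huU _)]
    refine ⟨fun h => ?_, fun h => by simp [h]⟩
    by_contra ha
    exact hxU (mem_of_pow_val_mem (hexp x) h ha)
  have hmW : ∀ {a b c d}, E a b c d ∈ W ↔ b = 0 := by
    intro a b c d
    simp only [hE]
    rw [mul_mem_cancel_right (W.pow_mem (hVW (hLV hz)) _),
      mul_mem_cancel_right (W.pow_mem (hVW hwV) _), mul_mem_cancel_left (W.pow_mem hxW _)]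
    refine ⟨fun h => ?_, fun h => by simp [h]⟩
    by_contra ha
    exact huW (mem_of_pow_val_mem (hexp u) h ha)
  have hmV : ∀ {a b c d}, E a b c d ∈ V ↔ a = 0 ∧ b = 0 := by
    intro a b c d
    rw [← hWU, Subgroup.mem_inf, hmU, hmW, and_comm]
  have hmL : ∀ {a b c d}, E a b c d ∈ L ↔ a = 0 ∧ b = 0 ∧ c = 0 := by
    intro a b c d
    constructor
    · intro h
      obtain ⟨rfl, rfl⟩ := hmV.1 (hLV h)
      refine ⟨rfl, rfl, ?_⟩
      simp only [hE] at h
      rw [mul_mem_cancel_right (L.pow_mem hz _), ZMod.val_zero, pow_zero, pow_zero, one_mul,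
        one_mul] at h
      by_contra hc
      exact hwL (mem_of_pow_val_mem (hexp w) h hc)
    · rintro ⟨rfl, rfl, rfl⟩
      simpa [hE] using L.pow_mem hz _
  have hm1 : ∀ {a b c d}, E a b c d = 1 → a = 0 ∧ b = 0 ∧ c = 0 ∧ d = 0 := by
    intro a b c d h
    obtain ⟨rfl, rfl, rfl⟩ := hmL.1 (h ▸ L.one_mem)
    refine ⟨rfl, rfl, rfl, ?_⟩
    by_contra hd
    have h1 : z ^ d.val ∈ (⊥ : Subgroup G) := by simpa [hE] using h
    exact hz1 (mem_of_pow_val_mem (hexp _) h1 hd)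
  have h0 : E 0 0 0 0 = 1 := by simp [hE]
  have hinj : ∀ {a b c d a' b' c' d'}, E a b c d = E a' b' c' d' →
      a = a' ∧ b = b' ∧ c = c' ∧ d = d' := by
    intro a b c d a' b' c' d' h
    have h1 : E (a + -a') (b + -b') (c + -c') (d + -d') = 1 := by
      rw [← hmul, h, hmul]
      simp [h0]
    obtain ⟨h1, h2, h3, h4⟩ := hm1 h1
    exact ⟨by rwa [← sub_eq_add_neg, sub_eq_zero] at h1,
      by rwa [← sub_eq_add_neg, sub_eq_zero] at h2,
      by rwa [← sub_eq_add_neg, sub_eq_zero] at h3, by rwa [← sub_eq_add_neg, sub_eq_zero] at h4⟩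
  refine ⟨E, ⟨hmul, hinj, ?_, hmU, hmW, hmV, hmL⟩, ?_⟩
  -- Surjectivity comes from injectivity by counting p ^ 4 elements on both sides.
  · have hb : Function.Bijective
        (fun q : ZMod p × ZMod p × ZMod p × ZMod p => E q.1 q.2.1 q.2.2.1 q.2.2.2) := by
      have hI : Function.Injective
          (fun q : ZMod p × ZMod p × ZMod p × ZMod p => E q.1 q.2.1 q.2.2.1 q.2.2.2) := by
        rintro ⟨a, b, c, d⟩ ⟨a', b', c', d'⟩ h
        obtain ⟨rfl, rfl, rfl, rfl⟩ := hinj h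
        rfl
      refine hI.bijective_of_nat_card_le ?_
      rw [hcard]
      simp only [Nat.card_prod, Nat.card_zmod]
      exact le_of_eq (by ring)
    intro g
    obtain ⟨q, hq⟩ := hb.2 g
    exact ⟨_, _, _, _, hq⟩
  · simp [hE, ZMod.val_one]

namespace IsCoordinates

variable {E : ZMod p → ZMod p → ZMod p → ZMod p → G} {U W V L : Subgroup G}

theorem one (hE : IsCoordinates E U W V L) : E 0 0 0 0 = 1 := by
  have := hE.mul 0 0 0 0 0 0 0 0
  simpa using this

theorem inv (hE : IsCoordinates E U W V L) (a b c d : ZMod p) :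
    (E a b c d)⁻¹ = E (-a) (-b) (-c) (-d) := by
  rw [inv_eq_iff_mul_eq_one, hE.mul]
  simpa using hE.one

theorem pow (hE : IsCoordinates E U W V L) (a b c d : ZMod p) (n : ℕ) :
    E a b c d ^ n = E (n * a) (n * b) (n * c) (n * d) := by
  induction n with
  | zero => simpa using hE.one.symm
  | succ n ih =>
    rw [pow_succ, ih, hE.mul]
    push_cast
    simp only [add_mul, one_mul]

end IsCoordinates

end Coordinates

end SRing

namespace SRing

/-! ### Restricting automorphisms to U -/

section InducedAutomorphisms

variable {G : Type*} [Group G] [Finite G]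

theorem inducedPerms_subset (A : SRing G) {U : Subgroup G} (hU : A.IsASubgroup U) :
    inducedPerms (A.autGroup : Set (Equiv.Perm G)) U ⊆
      ((A.restrict U hU).autGroup : Set (Equiv.Perm U)) := by
  rintro h ⟨f, hf, -, hfh⟩
  obtain ⟨φ, hφ, hφX⟩ := (A.mem_autGroup_iff f).1 hf
  refine (mem_autGroup_iff _ h).2 ⟨MulEquiv.mk h fun u v => Subtype.ext ?_, fun _ => rfl,
    fun Y hY y hy => ?_⟩
  · change (h (u * v) : G) = h u * h v
    rw [hfh, hfh, hfh, ← hφ, ← hφ, ← hφ]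
    simp
  · have h1 := hφX _ (mem_restrict_basicSets.1 hY) (y : G) ⟨y, hy, rfl⟩
    obtain ⟨y', hy', h2⟩ := h1
    have h3 : y' = h y := Subtype.ext (by rw [hfh, h2, hφ])
    change h y ∈ Y
    rwa [← h3]

end InducedAutomorphisms

/-! ### Basic sets in adapted coordinates; thin planes -/

section Adapted

variable {G : Type*} [CommGroup G] [Finite G] {p : ℕ} [Fact p.Prime]

/-- The set of elements with given first two coordinates, a coset of `V`. -/
def plane (E : ZMod p → ZMod p → ZMod p → ZMod p → G) (a b : ZMod p) : Set G :=
  Set.range fun q : ZMod p × ZMod p => E a b q.1 q.2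

/-- All basic sets that meet `plane E a b` lie in cosets of `L`. -/
def IsThin (A : SRing G) (E : ZMod p → ZMod p → ZMod p → ZMod p → G) (a b : ZMod p) : Prop :=
  ∀ c d, ∀ X ∈ A.basicSets, E a b c d ∈ X → X ⊆ Set.range (E a b c)

/-- Coordinates adapted to an S-ring whose basic sets in `U` are those of the iterated wreath
product with flag `L < V < U`, while its basic sets outside `W` are `L`-invariant. -/
structure IsAdapted (A : SRing G) (E : ZMod p → ZMod p → ZMod p → ZMod p → G)
    (U W V L : Subgroup G) : Prop extends IsCoordinates E U W V L where
  isPSRing : A.IsPSRing p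
  isASubgroup_U : A.IsASubgroup U
  isASubgroup_L : A.IsASubgroup L
  point_mem : ∀ d, {E 0 0 0 d} ∈ A.basicSets
  line_mem : ∀ c, c ≠ 0 → Set.range (E 0 0 c) ∈ A.basicSets
  plane_mem : ∀ b, b ≠ 0 → plane E 0 b ∈ A.basicSets
  eq_of_mem : ∀ {X}, X ∈ A.basicSets → ∀ {a b c d a' b' c' d'}, E a b c d ∈ X →
    E a' b' c' d' ∈ X → a = a' ∧ b = b'
  invariant : ∀ {X}, X ∈ A.basicSets → ∀ {a b c d}, b ≠ 0 → E a b c d ∈ X → ∀ d', E a b c d' ∈ X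

namespace IsCoordinates

variable {E : ZMod p → ZMod p → ZMod p → ZMod p → G} {U W V L : Subgroup G}

theorem mem_plane (hE : IsCoordinates E U W V L) {a b a' b' c d : ZMod p} :
    E a' b' c d ∈ plane E a b ↔ a' = a ∧ b' = b := by
  constructor
  · rintro ⟨q, hq⟩
    obtain ⟨rfl, rfl, -, -⟩ := hE.inj hq
    exact ⟨rfl, rfl⟩
  · rintro ⟨rfl, rfl⟩
    exact ⟨(c, d), rfl⟩

theorem mem_line (hE : IsCoordinates E U W V L) {a b c a' b' c' d' : ZMod p} :
    E a' b' c' d' ∈ Set.range (E a b c) ↔ a' = a ∧ b' = b ∧ c' = c := by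
  constructor
  · rintro ⟨q, hq⟩
    obtain ⟨rfl, rfl, rfl, -⟩ := hE.inj hq
    exact ⟨rfl, rfl, rfl⟩
  · rintro ⟨rfl, rfl, rfl⟩
    exact ⟨d', rfl⟩

theorem ncard_plane (hE : IsCoordinates E U W V L) (a b : ZMod p) :
    (plane E a b).ncard = p ^ 2 := by
  rw [plane, ← Set.image_univ, Set.ncard_image_of_injective, Set.ncard_univ, Nat.card_prod,
    Nat.card_zmod, sq]
  rintro ⟨c, d⟩ ⟨c', d'⟩ h
  obtain ⟨-, -, rfl, rfl⟩ := hE.inj h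
  rfl

theorem ncard_line (hE : IsCoordinates E U W V L) (a b c : ZMod p) :
    (Set.range (E a b c)).ncard = p := by
  rw [← Set.image_univ, Set.ncard_image_of_injective, Set.ncard_univ, Nat.card_zmod]
  intro d d' h
  exact (hE.inj h).2.2.2

theorem plane_eq_smul (hE : IsCoordinates E U W V L) (a b : ZMod p) :
    plane E a b = E a b 0 0 • (V : Set G) := by
  ext g
  obtain ⟨a', b', c, d, rfl⟩ := hE.surj g
  rw [hE.mem_plane, Set.mem_smul_set_iff_inv_smul_mem, hE.inv, smul_eq_mul, hE.mul,
    SetLike.mem_coe, hE.mem_V, neg_add_eq_zero, neg_add_eq_zero, eq_comm, @eq_comm _ b']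

theorem card_W (hE : IsCoordinates E U W V L) : Nat.card W = p ^ 3 := by
  have hb : Function.Bijective
      (fun q : ZMod p × ZMod p × ZMod p => (⟨E q.1 0 q.2.1 q.2.2, hE.mem_W.2 rfl⟩ : W)) := by
    constructor
    · rintro ⟨a, c, d⟩ ⟨a', c', d'⟩ h
      obtain ⟨rfl, -, rfl, rfl⟩ := hE.inj (congrArg Subtype.val h)
      rfl
    · rintro ⟨g, hg⟩
      obtain ⟨a, b, c, d, rfl⟩ := hE.surj g
      obtain rfl := hE.mem_W.1 hg
      exact ⟨(a, c, d), rfl⟩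
  rw [← Nat.card_congr (Equiv.ofBijective _ hb)]
  simp only [Nat.card_prod, Nat.card_zmod]
  ring

/-- The unitriangular automorphisms, in coordinates. -/
theorem exists_mulAut (hE : IsCoordinates E U W V L) (s t r s' t' : ZMod p) :
    ∃ Φ : MulAut G, ∀ a b c d,
      Φ (E a b c d) = E a b (c + s * a + t * b) (d + r * c + s' * a + t' * b) := by
  choose x y z w hg using hE.surj
  let φ : G → G := fun g =>
    E (x g) (y g) (z g + s * x g + t * y g) (w g + r * z g + s' * x g + t' * y g)
  have hφ : ∀ a b c d, φ (E a b c d) =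
      E a b (c + s * a + t * b) (d + r * c + s' * a + t' * b) := by
    intro a b c d
    obtain ⟨h1, h2, h3, h4⟩ := hE.inj (hg (E a b c d))
    simp only [φ, h1, h2, h3, h4]
  have hmul : ∀ g h, φ (g * h) = φ g * φ h := by
    intro g h
    obtain ⟨a, b, c, d, rfl⟩ := hE.surj g
    obtain ⟨a', b', c', d', rfl⟩ := hE.surj h
    rw [hE.mul, hφ, hφ, hφ, hE.mul]
    congr 1 <;> ring
  have hinj : Function.Injective φ := by
    intro g h hgh
    obtain ⟨a, b, c, d, rfl⟩ := hE.surj g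
    obtain ⟨a', b', c', d', rfl⟩ := hE.surj h
    rw [hφ, hφ] at hgh
    obtain ⟨rfl, rfl, h3, h4⟩ := hE.inj hgh
    obtain rfl : c = c' := by simpa using h3
    obtain rfl : d = d' := by simpa using h4
    rfl
  exact ⟨MulEquiv.ofBijective (MonoidHom.mk' φ hmul) (Finite.injective_iff_bijective.1 hinj), hφ⟩

end IsCoordinates

theorem exists_isAdapted (hexp : ∀ g : G, g ^ p = 1) (hcard : Nat.card G = p ^ 4) {A : SRing G}
    (hA : A.IsPSRing p) {U V L W : Subgroup G} (h : A.IsWreathFlag p U V L)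
    (hW : A.IsASubgroup W) (hWU : W ⊓ U = V)
    (hinv : ∀ X ∈ A.basicSets, ∀ x ∈ X, x ∉ W → ∀ l ∈ L, l * x ∈ X) {x : G} (hxW : x ∈ W)
    (hxU : x ∉ U) :
    ∃ E : ZMod p → ZMod p → ZMod p → ZMod p → G, A.IsAdapted E U W V L ∧ E 1 0 0 0 = x := by
  have hp := (Fact.out : p.Prime)
  have hex : ∀ {H K : Subgroup G}, Nat.card H < Nat.card K → ∃ g ∈ K, g ∉ H := by
    intro H K hHK
    by_contra! hc
    have h2 : Nat.card K ≤ Nat.card H := Nat.card_mono (Set.toFinite _) (show K ≤ H from hc)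
    omega
  obtain ⟨u, huU, huV⟩ := hex (H := V) (K := U) (by
    rw [h.card_V, h.card_U]; exact Nat.pow_lt_pow_right hp.one_lt (by norm_num))
  obtain ⟨w, hwV, hwL⟩ := hex (H := L) (K := V) (by
    rw [h.card_V, h.card_L]; exact lt_self_pow₀ hp.one_lt (by norm_num))
  have hL : L ≠ ⊥ := by
    rintro rfl
    have := h.card_L
    rw [Subgroup.card_bot] at this
    exact hp.one_lt.ne this
  obtain ⟨E, hE, hx⟩ := exists_isCoordinates hexp hcard h.le_V hWU hL hxW hxU huU huV hwV hwL
  have hindex : ∀ {H : Subgroup G}, Nat.card H = p ^ 3 → H.index = p := by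
    intro H hH
    have := H.card_mul_index
    rw [hH, hcard, pow_succ p 3] at this
    exact Nat.eq_of_mul_eq_mul_left (pow_pos hp.pos 3) this
  refine ⟨E, ⟨hE, hA, h.isASubgroup_U, h.isASubgroup_L, ?_, ?_, ?_, ?_, ?_⟩,
    hx⟩
  · intro d
    obtain ⟨X, hX, hdX⟩ := A.exists_basicSet (E 0 0 0 d)
    rwa [← h.singleton X hX _ hdX (hE.mem_L.2 ⟨rfl, rfl, rfl⟩)]
  · intro c hc
    obtain ⟨X, hX, hdX⟩ := A.exists_basicSet (E 0 0 c 0)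
    suffices X = Set.range (E 0 0 c) by rwa [← this]
    ext y
    rw [h.coset_L X hX _ hdX (fun h => hc (hE.mem_L.1 h).2.2) (hE.mem_V.2 ⟨rfl, rfl⟩)]
    obtain ⟨a', b', c', d', rfl⟩ := hE.surj y
    rw [hE.inv, hE.mul, hE.mem_L, hE.mem_line]
    simp only [neg_zero, add_zero, add_neg_eq_zero]
  · intro b hb
    obtain ⟨X, hX, hdX⟩ := A.exists_basicSet (E 0 b 0 0)
    suffices X = plane E 0 b by rwa [← this]
    ext y
    rw [h.coset_V X hX _ hdX (hE.mem_U.2 rfl) (fun h => hb (hE.mem_V.1 h).2)]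
    obtain ⟨a', b', c', d', rfl⟩ := hE.surj y
    rw [hE.inv, hE.mul, hE.mem_V, hE.mem_plane]
    simp only [neg_zero, add_zero, add_neg_eq_zero]
  -- U and W both have index p, so a basic set lies in one coset of each and the coordinates a and b
  -- are constant on it.
  · intro X hX a b c d a' b' c' d' h1 h2
    have hU := inv_mul_mem_of_index_eq hp hA h.isASubgroup_U (hindex h.card_U) hX h1 h2
    have hW' := inv_mul_mem_of_index_eq hp hA hW (hindex hE.card_W) hX h1 h2
    rw [hE.inv, hE.mul] at hU hW'
    exact ⟨neg_add_eq_zero.1 (hE.mem_U.1 hU), neg_add_eq_zero.1 (hE.mem_W.1 hW')⟩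
  · intro X hX a b c d hb hm d'
    have := hinv X hX _ hm (fun h => hb (hE.mem_W.1 h)) (E 0 0 0 (d' - d))
      (hE.mem_L.2 ⟨rfl, rfl, rfl⟩)
    rw [hE.mul] at this
    simpa using this

namespace IsAdapted

variable {A : SRing G} {E : ZMod p → ZMod p → ZMod p → ZMod p → G} {U W V L : Subgroup G}

theorem subset_plane (h : A.IsAdapted E U W V L) {X : Set G} (hX : X ∈ A.basicSets)
    {a b c d : ZMod p} (hm : E a b c d ∈ X) : X ⊆ plane E a b := by
  intro g hg
  obtain ⟨a', b', c', d', rfl⟩ := h.surj g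
  exact h.mem_plane.2 (h.eq_of_mem hX hg hm)

theorem line_subset (h : A.IsAdapted E U W V L) {X : Set G} (hX : X ∈ A.basicSets)
    {a b c d : ZMod p} (hb : b ≠ 0) (hm : E a b c d ∈ X) : Set.range (E a b c) ⊆ X := by
  rintro _ ⟨d', rfl⟩
  exact h.invariant hX hb hm d'

/-- A basic set here is a union of `L`-cosets of p-power size; if one is larger than an `L`-coset,
it has p² elements and fills the plane. -/
theorem plane_mem_or_isThin (h : A.IsAdapted E U W V L) (a : ZMod p) {b : ZMod p} (hb : b ≠ 0) :
    plane E a b ∈ A.basicSets ∨ A.IsThin E a b := by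
  have hp := (Fact.out : p.Prime)
  by_contra! hc
  obtain ⟨hc1, hc2⟩ := hc
  simp only [IsThin, not_forall] at hc2
  obtain ⟨c, d, X, hX, hm, hsub⟩ := hc2
  refine hc1 ?_
  suffices X = plane E a b by rwa [← this]
  obtain ⟨k, hk⟩ := h.isPSRing X hX
  refine Set.eq_of_subset_of_ncard_le (h.subset_plane hX hm) ?_ (Set.toFinite _)
  rw [h.ncard_plane, hk]
  refine Nat.pow_le_pow_right hp.pos ?_
  have hlt := Set.ncard_lt_ncard (ssubset_of_subset_not_subset (h.line_subset hX hb hm) hsub)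
    (Set.toFinite _)
  rw [h.ncard_line, hk] at hlt
  exact (Nat.pow_lt_pow_iff_right hp.one_lt).1 (by simpa using hlt)

theorem isThin_zero (h : A.IsAdapted E U W V L) : A.IsThin E 0 0 := by
  intro c d X hX hm
  by_cases hc : c = 0
  · subst hc
    rw [A.basicSet_unique hX (h.point_mem d) hm rfl]
    rintro _ rfl
    exact ⟨d, rfl⟩
  · rw [A.basicSet_unique hX (h.line_mem c hc) hm ⟨d, rfl⟩]

/-- A basic set meeting the product of two basic sets lying in cosets of `L` lies in a coset of
`L`. -/
theorem subset_line_of_mul (h : A.IsAdapted E U W V L) {X Y Z : Set G} (hX : X ∈ A.basicSets)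
    (hY : Y ∈ A.basicSets) (hZ : Z ∈ A.basicSets) {a b c d a' b' c' d' : ZMod p}
    (hXm : E a b c d ∈ X) (hYm : E a' b' c' d' ∈ Y) (hXl : X ⊆ Set.range (E a b c))
    (hYl : Y ⊆ Set.range (E a' b' c')) (hZm : E (a + a') (b + b') (c + c') (d + d') ∈ Z) :
    Z ⊆ Set.range (E (a + a') (b + b') (c + c')) := by
  intro z hz
  rw [← h.mul] at hZm
  obtain ⟨x, hx, y, hy, rfl⟩ := A.exists_mul_of_mem hX hY hZ hXm hYm hZm hz
  obtain ⟨e, rfl⟩ := hXl hx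
  obtain ⟨e', rfl⟩ := hYl hy
  exact ⟨e + e', (h.mul _ _ _ _ _ _ _ _).symm⟩

/-- One basic set inside an `L`-coset is enough: multiplying it by the basic sets of V, themselves
inside `L`-cosets, reaches the whole plane. -/
theorem isThin_of_subset (h : A.IsAdapted E U W V L) {X : Set G} (hX : X ∈ A.basicSets)
    {a b c d : ZMod p} (hm : E a b c d ∈ X) (hl : X ⊆ Set.range (E a b c)) : A.IsThin E a b := by
  intro c' d' Z hZ hZm
  obtain ⟨Y, hY, hYm⟩ := A.exists_basicSet (E 0 0 (c' - c) (d' - d))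
  have := h.subset_line_of_mul hX hY hZ hm hYm hl (h.isThin_zero _ _ Y hY hYm)
    (by simpa using hZm)
  simpa using this

theorem isThin_add (h : A.IsAdapted E U W V L) {a b a' b' : ZMod p} (h1 : A.IsThin E a b)
    (h2 : A.IsThin E a' b') : A.IsThin E (a + a') (b + b') := by
  obtain ⟨X, hX, hXm⟩ := A.exists_basicSet (E a b 0 0)
  obtain ⟨Y, hY, hYm⟩ := A.exists_basicSet (E a' b' 0 0)
  obtain ⟨Z, hZ, hZm⟩ := A.exists_basicSet (E (a + a') (b + b') (0 + 0) (0 + 0))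
  exact h.isThin_of_subset hZ hZm
    (h.subset_line_of_mul hX hY hZ hXm hYm (h1 _ _ X hX hXm) (h2 _ _ Y hY hYm) hZm)

theorem isThin_smul (h : A.IsAdapted E U W V L) {a b : ZMod p} (h1 : A.IsThin E a b)
    (k : ZMod p) : A.IsThin E (k * a) (k * b) := by
  have key : ∀ n : ℕ, A.IsThin E (n * a) (n * b) := by
    intro n
    induction n with
    | zero => simpa using h.isThin_zero
    | succ n ih =>
      have := h.isThin_add ih h1
      push_cast
      rwa [add_mul, add_mul, one_mul, one_mul]
  have := key k.val
  rwa [ZMod.natCast_zmod_val] at this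

theorem not_isThin_zero_left (h : A.IsAdapted E U W V L) {b : ZMod p} (hb : b ≠ 0) :
    ¬ A.IsThin E 0 b := by
  intro ht
  have h1 := ht 0 0 _ (h.plane_mem b hb) (h.mem_plane.2 ⟨rfl, rfl⟩)
  have h2 : E 0 b 1 0 ∈ plane E 0 b := h.mem_plane.2 ⟨rfl, rfl⟩
  exact one_ne_zero (h.mem_line.1 (h1 h2)).2.2

theorem line_mem_of_isThin (h : A.IsAdapted E U W V L) {a b : ZMod p} (hb : b ≠ 0)
    (ht : A.IsThin E a b) (c : ZMod p) : Set.range (E a b c) ∈ A.basicSets := by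
  obtain ⟨X, hX, hm⟩ := A.exists_basicSet (E a b c 0)
  rwa [← (ht c 0 X hX hm).antisymm (h.line_subset hX hb hm)]

/-- The automorphisms of `A_U` extend if suitable unitriangular maps preserve the basic sets. -/
theorem autGroup_restrict_subset (h : A.IsAdapted E U W V L)
    (H : ∀ t t' r, ∃ s s', ∀ X ∈ A.basicSets, ∀ a b c d, E a b c d ∈ X →
      E a b (c + s * a + t * b) (d + r * c + s' * a + t' * b) ∈ X) :
    ((A.restrict U h.isASubgroup_U).autGroup : Set (Equiv.Perm U)) ⊆
      inducedPerms (A.autGroup : Set (Equiv.Perm G)) U := by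
  intro f hf
  obtain ⟨φ, hφf, hφ⟩ := (mem_autGroup_iff _ f).1 hf
  have hpres : ∀ X ∈ A.basicSets, ∀ u : U, (u : G) ∈ X → (φ u : G) ∈ X := by
    intro X hX u hu
    exact hφ _ (preimage_mem_restrict h.isASubgroup_U hX hu u.2) u hu
  -- Preserving basic sets fixes u₃, moves u₂ within an `L`-coset and u₁ within a `V`-coset. So φ is
  -- determined by r, t, t', and `H` supplies the image of the remaining generator.
  set u₁ : U := ⟨E 0 1 0 0, h.mem_U.2 rfl⟩ with hu₁
  set u₂ : U := ⟨E 0 0 1 0, h.mem_U.2 rfl⟩ with hu₂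
  set u₃ : U := ⟨E 0 0 0 1, h.mem_U.2 rfl⟩ with hu₃
  obtain ⟨⟨t, t'⟩, h1⟩ := hpres _ (h.plane_mem 1 one_ne_zero) u₁ (h.mem_plane.2 ⟨rfl, rfl⟩)
  obtain ⟨r, h2⟩ := hpres _ (h.line_mem 1 one_ne_zero) u₂ ⟨0, rfl⟩
  have h3 : (φ u₃ : G) = E 0 0 0 1 := hpres _ (h.point_mem 1) u₃ rfl
  have hφU : ∀ (u : U) (b c d : ZMod p), (u : G) = E 0 b c d →
      (φ u : G) = E 0 b (c + t * b) (d + r * c + t' * b) := by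
    intro u b c d hu
    have hu' : u = u₁ ^ b.val * u₂ ^ c.val * u₃ ^ d.val := by
      apply Subtype.ext
      push_cast
      rw [hu, h.pow, h.pow, h.pow, h.mul, h.mul]
      simp
    rw [hu']
    simp only [map_mul, map_pow, Subgroup.coe_mul, Subgroup.coe_pow, h3]
    rw [← h1, ← h2]
    simp only [h.pow, h.mul, ZMod.natCast_zmod_val]
    congr 1 <;> ring
  obtain ⟨s, s', hs⟩ := H t t' r
  obtain ⟨Φ, hΦ⟩ := h.exists_mulAut s t r s' t'
  have hΦU : ∀ u : U, (f u : G) = Φ u := by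
    intro u
    obtain ⟨a, b, c, d, hu⟩ := h.surj (u : G)
    have ha : a = 0 := h.mem_U.1 (hu ▸ u.2)
    subst ha
    rw [← hφf, hφU u b c d hu.symm, ← hu, hΦ]
    simp
  refine ⟨MulAut.toPerm G Φ, (mem_autGroup_iff _ _).2 ⟨Φ, fun _ => rfl, fun X hX x hx => ?_⟩, ?_,
    hΦU⟩
  · obtain ⟨a, b, c, d, rfl⟩ := h.surj x
    rw [hΦ]
    exact hs X hX a b c d hx
  · refine Set.eq_of_subset_of_ncard_le ?_ ?_ (Set.toFinite _)
    · rintro _ ⟨x, hx, rfl⟩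
      obtain ⟨a, b, c, d, rfl⟩ := h.surj x
      have ha := h.mem_U.1 hx
      change Φ (E a b c d) ∈ U
      rw [hΦ]
      exact h.mem_U.2 ha
    · rw [Set.ncard_image_of_injective _ (MulAut.toPerm G Φ).injective]

end IsAdapted

end Adapted

end SRing

namespace SRing

section Cases

variable {G : Type*} [CommGroup G] [Finite G] {p : ℕ} [Fact p.Prime]

theorem mem_setRadical_of_forall {X : Set G} {g : G} (h : ∀ x ∈ X, g * x ∈ X) :
    g ∈ setRadical X := by
  have h1 : g • X = X := by
    refine Set.eq_of_subset_of_ncard_le ?_ ?_ (Set.toFinite _)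
    · rintro _ ⟨x, hx, rfl⟩
      exact h x hx
    · exact (Set.ncard_image_of_injective X (MulAction.injective g)).ge
  refine ⟨h1, ?_⟩
  rw [← h1, op_smul_eq_smul, h1, h1]

namespace IsAdapted

variable {A : SRing G} {E : ZMod p → ZMod p → ZMod p → ZMod p → G} {U W V L : Subgroup G}

/-! ### First case: a one-element basic set in W \ U -/

section Singleton

theorem singleton_mem (h : A.IsAdapted E U W V L) (hx : {E 1 0 0 0} ∈ A.basicSets)
    (a d : ZMod p) : {E a 0 0 d} ∈ A.basicSets := by
  have h1 := A.singleton_mul_mem (A.singleton_pow_mem hx a.val) (h.point_mem d)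
  rw [h.pow, h.mul] at h1
  simpa using h1

theorem line_mem_of_singleton (h : A.IsAdapted E U W V L) (hx : {E 1 0 0 0} ∈ A.basicSets)
    (a : ZMod p) {c : ZMod p} (hc : c ≠ 0) : Set.range (E a 0 c) ∈ A.basicSets := by
  have h1 := A.smul_mem_basicSets (h.singleton_mem hx a 0) (h.line_mem c hc)
  suffices E a 0 0 0 • Set.range (E 0 0 c) = Set.range (E a 0 c) by rwa [← this]
  ext g
  obtain ⟨a', b', c', d', rfl⟩ := h.surj g
  rw [Set.mem_smul_set_iff_inv_smul_mem, h.inv, smul_eq_mul, h.mul, h.mem_line, h.mem_line]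
  simp [neg_add_eq_zero, eq_comm]

theorem plane_mem_of_singleton (h : A.IsAdapted E U W V L) (hx : {E 1 0 0 0} ∈ A.basicSets)
    (a : ZMod p) {b : ZMod p} (hb : b ≠ 0) : plane E a b ∈ A.basicSets := by
  have h1 := A.smul_mem_basicSets (h.singleton_mem hx a 0) (h.plane_mem b hb)
  suffices E a 0 0 0 • plane E 0 b = plane E a b by rwa [← this]
  ext g
  obtain ⟨a', b', c', d', rfl⟩ := h.surj g
  rw [Set.mem_smul_set_iff_inv_smul_mem, h.inv, smul_eq_mul, h.mul, h.mem_plane, h.mem_plane]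
  simp [neg_add_eq_zero, eq_comm]

/-- Every basic set is a point with b = c = 0, an `L`-coset with b = 0 or a whole plane, so the
extension fixing `E 1 0 0 0` (s = s' = 0) preserves all of them. -/
theorem autGroup_restrict_subset_of_singleton (h : A.IsAdapted E U W V L)
    (hx : {E 1 0 0 0} ∈ A.basicSets) :
    ((A.restrict U h.isASubgroup_U).autGroup : Set (Equiv.Perm U)) ⊆
      inducedPerms (A.autGroup : Set (Equiv.Perm G)) U := by
  refine h.autGroup_restrict_subset fun t t' r => ⟨0, 0, fun X hX a b c d hm => ?_⟩
  by_cases hb : b = 0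
  · subst hb
    by_cases hc : c = 0
    · subst hc
      simpa using hm
    · rw [A.basicSet_unique hX (h.line_mem_of_singleton hx a hc) hm ⟨d, rfl⟩, h.mem_line]
      simp
  · rw [A.basicSet_unique hX (h.plane_mem_of_singleton hx a hb) hm (h.mem_plane.2 ⟨rfl, rfl⟩),
      h.mem_plane]
    exact ⟨rfl, rfl⟩

end Singleton

/-! ### Second case: parabolas in W -/

section Transversal

theorem setRadical_ne (h : A.IsAdapted E U W V L) {X : Set G}
    (hX : ∀ a b c d, E a b c d ∈ X → E a b c (d + 1) ∈ X) : setRadical X ≠ {1} := by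
  intro hr
  have h1 : E 0 0 0 1 ∈ setRadical X := mem_setRadical_of_forall fun x hx => by
    obtain ⟨a, b, c, d, rfl⟩ := h.surj x
    rw [h.mul]
    simpa [add_comm] using hX a b c d hx
  rw [hr, Set.mem_singleton_iff, ← h.one] at h1
  exact one_ne_zero (h.inj h1).2.2.2

/-- A basic set of trivial radical in the plane through `E 1 0 0 0` that is not a singleton is
the graph of a function. -/
theorem exists_eq_graph (h : A.IsAdapted E U W V L) {X : Set G} (hX : X ∈ A.basicSets)
    (hm : E 1 0 0 0 ∈ X) (hne : {E 1 0 0 0} ∉ A.basicSets) (hr : setRadical X = {1}) :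
    ∃ f : ZMod p → ZMod p, f 0 = 0 ∧ ∀ i d, E 1 0 i d ∈ X ↔ d = f i := by
  have hp := (Fact.out : p.Prime)
  have hsub := h.subset_plane hX hm
  obtain ⟨k, hk⟩ := h.isPSRing X hX
  have hk2 : k ≤ 2 := by
    have := Set.ncard_le_ncard hsub (Set.toFinite _)
    rw [h.ncard_plane, hk] at this
    exact (Nat.pow_le_pow_iff_right hp.one_lt).1 this
  have hk0 : k ≠ 0 := by
    rintro rfl
    obtain ⟨y, rfl⟩ := Set.ncard_eq_one.1 (hk.trans (pow_zero p))
    rw [Set.mem_singleton_iff.1 hm] at hne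
    exact hne hX
  have hk2' : k ≠ 2 := by
    rintro rfl
    have : X = plane E 1 0 :=
      Set.eq_of_subset_of_ncard_le hsub (by rw [h.ncard_plane, hk]) (Set.toFinite _)
    refine h.setRadical_ne (fun a b c d hd => ?_) hr
    rw [this, h.mem_plane] at hd ⊢
    exact hd
  obtain rfl : k = 1 := by omega
  rw [pow_one] at hk
  obtain ⟨n, hn, hnm⟩ := A.exists_ncard_eq_mul h.isASubgroup_L hX
  have huniq : ∀ i d d', E 1 0 i d ∈ X → E 1 0 i d' ∈ X → d = d' := by
    intro i d d' hd hd'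
    -- X has p elements and meets each `L`-coset it touches in n points. For n = p it would be an
    -- `L`-coset, with nontrivial radical, so n = 1.
    rcases (Nat.dvd_prime hp).1 (Dvd.intro _ (hnm.symm.trans hk)) with h1 | h1
    · obtain ⟨y, hy⟩ := Set.ncard_eq_one.1 ((hn _ hd).trans h1)
      have e1 : E 1 0 i d ∈ {x ∈ X | x⁻¹ * E 1 0 i d ∈ L} := ⟨hd, by simp⟩
      have e2 : E 1 0 i d' ∈ {x ∈ X | x⁻¹ * E 1 0 i d ∈ L} := by
        refine ⟨hd', ?_⟩
        rw [h.inv, h.mul, h.mem_L]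
        simp
      rw [hy] at e1 e2
      exact (h.inj (e1.trans e2.symm)).2.2.2
    · exfalso
      have e1 : {x ∈ X | x⁻¹ * E 1 0 0 0 ∈ L} = X :=
        Set.eq_of_subset_of_ncard_le (fun x hx => hx.1) (by rw [hn _ hm, hk, h1]) (Set.toFinite _)
      have e2 : X ⊆ Set.range (E 1 0 0) := by
        intro x hx
        rw [← e1] at hx
        have hxL := hx.2
        obtain ⟨a, b, c, d, rfl⟩ := h.surj x
        rw [h.inv, h.mul, h.mem_L] at hxL
        rw [h.mem_line]
        simpa [neg_add_eq_zero] using hxL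
      have e3 : X = Set.range (E 1 0 0) :=
        Set.eq_of_subset_of_ncard_le e2 (by rw [h.ncard_line, hk]) (Set.toFinite _)
      refine h.setRadical_ne (fun a b c d hd => ?_) hr
      rw [e3, h.mem_line] at hd ⊢
      exact hd
  have hex : ∀ i, ∃ d, E 1 0 i d ∈ X := by
    set D : Set (ZMod p × ZMod p) := {q | E 1 0 q.1 q.2 ∈ X} with hD
    have hDX : (fun q : ZMod p × ZMod p => E 1 0 q.1 q.2) '' D = X := by
      ext x
      constructor
      · rintro ⟨q, hq, rfl⟩
        exact hq
      · intro hx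
        obtain ⟨q, rfl⟩ := hsub hx
        exact ⟨q, hx, rfl⟩
    have hDp : D.ncard = p := by
      refine Eq.trans ?_ hk
      rw [← hDX, Set.ncard_image_of_injective]
      rintro ⟨c, d⟩ ⟨c', d'⟩ hq
      obtain ⟨-, -, rfl, rfl⟩ := h.inj hq
      rfl
    have hfst : (Prod.fst '' D).ncard = p := by
      rw [Set.InjOn.ncard_image, hDp]
      rintro ⟨c, d⟩ hq ⟨c', d'⟩ hq' hcc
      obtain rfl : c = c' := hcc
      rw [huniq c d d' hq hq']
    have huniv : Prod.fst '' D = Set.univ :=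
      Set.eq_of_subset_of_ncard_le (Set.subset_univ _)
        (by rw [hfst, Set.ncard_univ, Nat.card_zmod]) (Set.toFinite _)
    intro i
    obtain ⟨⟨i', d⟩, hd, rfl⟩ : i ∈ Prod.fst '' D := huniv ▸ Set.mem_univ i
    exact ⟨d, hd⟩
  choose f hf using hex
  exact ⟨f, huniq 0 _ _ (hf 0) hm, fun i d => ⟨fun hd => huniq i _ _ hd (hf i),
    fun hd => hd ▸ hf i⟩⟩

/-- X X⁻¹ meets the basic set `Set.range (E 0 0 d)` and hence covers it: every e is a difference f
(j + d) - f j. -/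
theorem isPlanar_of_graph (h : A.IsAdapted E U W V L) {X : Set G} (hX : X ∈ A.basicSets)
    {f : ZMod p → ZMod p} (hsub : X ⊆ plane E 1 0) (hf : ∀ i d, E 1 0 i d ∈ X ↔ d = f i) :
    IsPlanar f := by
  intro d hd
  refine Function.Surjective.bijective_of_finite fun e => ?_
  have hX1 : E (-1) (-0) (-0) (-f 0) ∈ X⁻¹ := by
    rw [← h.inv]
    exact Set.inv_mem_inv.2 ((hf _ _).2 rfl)
  obtain ⟨x, hx, y, hy, hxy⟩ := A.exists_mul_of_mem (z := E 0 0 d e) hX (A.inv_mem X hX)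
    (h.line_mem d hd) ((hf d (f d)).2 rfl) hX1 (by rw [h.mul, h.mem_line]; simp) ⟨e, rfl⟩
  obtain ⟨⟨i, s⟩, rfl⟩ := hsub hx
  obtain ⟨⟨j, t⟩, ht⟩ := hsub (Set.mem_inv.1 hy)
  obtain rfl : s = f i := (hf _ _).1 hx
  obtain rfl : t = f j := (hf _ _).1 (by rw [show E 1 0 j t = y⁻¹ from ht]; exact hy)
  rw [← inv_inv y, ← ht] at hxy
  simp only [h.inv, h.mul] at hxy
  obtain ⟨-, -, h3, h4⟩ := h.inj hxy
  refine ⟨j, ?_⟩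
  rw [← sub_eq_add_neg, sub_eq_iff_eq_add'] at h3
  rw [← h3, ← h4, sub_eq_add_neg]

/-- X is a parabola because its function is planar. The power map with exponent a carries it to the
planes (a, 0), and the one-point basic sets in L supply the translates by l. -/
theorem exists_paraboloid (h : A.IsAdapted E U W V L) (hcard : Nat.card G = p ^ 4)
    (hns : ∀ a c d, a ≠ 0 → {E a 0 c d} ∉ A.basicSets) {X : Set G} (hX : X ∈ A.basicSets)
    (hm : E 1 0 0 0 ∈ X) (hr : setRadical X = {1}) :
    2 < p ∧ ∃ α β : ZMod p, α ≠ 0 ∧ ∀ a l, a ≠ 0 →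
      Set.range (fun i => E a 0 (a * i) (a * (α * i ^ 2 + β * i) + l)) ∈ A.basicSets := by
  have hp := (Fact.out : p.Prime)
  obtain ⟨f, hf0, hf⟩ := h.exists_eq_graph hX hm (hns 1 0 0 one_ne_zero) hr
  have hsub := h.subset_plane hX hm
  have hpl := h.isPlanar_of_graph hX hsub hf
  obtain ⟨α, β, γ, hα, hq⟩ := hpl.exists_quadratic
  obtain rfl : γ = 0 := by simpa [hf0] using (hq 0).symm
  refine ⟨hpl.two_lt, α, β, hα, fun a l ha => ?_⟩
  have hcop : (Nat.card G).Coprime a.val := by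
    rw [hcard]
    refine Nat.Coprime.pow_left 4 ((Nat.Prime.coprime_iff_not_dvd hp).2 fun hd => ?_)
    have := Nat.le_of_dvd (Nat.pos_of_ne_zero ((ZMod.val_ne_zero a).2 ha)) hd
    exact absurd (ZMod.val_lt a) (by omega)
  set T := (fun x : G => x ^ a.val) '' X with hT
  have hTA := A.groupRingSum_image_pow_mem hcop (A.groupRingSum_mem hX)
  have hTm : ∀ i, E a 0 (a * i) (a * f i) ∈ T := by
    intro i
    refine ⟨E 1 0 i (f i), (hf _ _).2 rfl, ?_⟩
    simp only [h.pow]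
    simp
  obtain ⟨Z, hZ, hZm⟩ := A.exists_basicSet (E a 0 (a * 0) (a * f 0))
  have hZT : Z ⊆ T := (A.groupRingSum_mem_iff _).1 hTA Z hZ _ hZm (hTm 0)
  have hXs : X ⊆ Set.range fun i => E 1 0 i (f i) := by
    intro x hx
    obtain ⟨⟨i, d⟩, rfl⟩ := hsub hx
    exact ⟨i, by simp only; rw [(hf i d).1 hx]⟩
  have hXc : X.ncard ≤ p := by
    refine (Set.ncard_le_ncard hXs (Set.toFinite _)).trans ?_
    rw [← Set.image_univ]
    exact (Set.ncard_image_le).trans (by rw [Set.ncard_univ, Nat.card_zmod])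
  -- Schur's theorem only makes T a union of basic sets. Since T has at most p points and no basic
  -- set in W \ U is a single point, Z already fills T.
  have hZe : Z = T := by
    refine Set.eq_of_subset_of_ncard_le hZT ?_ (Set.toFinite _)
    refine (Set.ncard_image_le).trans (hXc.trans ?_)
    obtain ⟨k, hk⟩ := h.isPSRing Z hZ
    rw [hk]
    refine Nat.le_self_pow ?_ p
    rintro rfl
    obtain ⟨y, rfl⟩ := Set.ncard_eq_one.1 (hk.trans (pow_zero p))
    rw [← Set.mem_singleton_iff.1 hZm] at hZ
    exact hns _ _ _ ha hZ
  have hl := A.smul_mem_basicSets (h.point_mem l) (hZe ▸ hZ)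
  suffices E 0 0 0 l • T = Set.range (fun i => E a 0 (a * i) (a * (α * i ^ 2 + β * i) + l)) by
    rwa [← this]
  have hqf : ∀ i, α * i ^ 2 + β * i = f i := fun i => by rw [hq, add_zero]
  simp only [hqf]
  apply Set.Subset.antisymm
  · rintro _ ⟨_, ⟨x, hx, rfl⟩, rfl⟩
    obtain ⟨i, rfl⟩ := hXs hx
    refine ⟨i, ?_⟩
    simp only [h.pow, smul_eq_mul, h.mul]
    simp [add_comm]
  · rintro _ ⟨i, rfl⟩
    refine ⟨_, hTm i, ?_⟩
    simp only [smul_eq_mul, h.mul]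
    simp [add_comm]

/-- On a parabola i = c / a becomes i + s. Comparing the linear terms gives r = 2 α s, and the
constant terms give s' = α s² + β s; t and t' play no role where b = 0. -/
theorem autGroup_restrict_subset_of_paraboloid (h : A.IsAdapted E U W V L)
    (h2 : (2 : ZMod p) ≠ 0) {α β : ZMod p} (hα : α ≠ 0)
    (hP : ∀ a l, a ≠ 0 →
      Set.range (fun i => E a 0 (a * i) (a * (α * i ^ 2 + β * i) + l)) ∈ A.basicSets)
    (hpl : ∀ a b, b ≠ 0 → plane E a b ∈ A.basicSets) :
    ((A.restrict U h.isASubgroup_U).autGroup : Set (Equiv.Perm U)) ⊆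
      inducedPerms (A.autGroup : Set (Equiv.Perm G)) U := by
  refine h.autGroup_restrict_subset fun t t' r =>
    ⟨r / (2 * α), α * (r / (2 * α)) ^ 2 + β * (r / (2 * α)), fun X hX a b c d hm => ?_⟩
  by_cases hb : b = 0
  · subst hb
    by_cases ha : a = 0
    · subst ha
      by_cases hc : c = 0
      · subst hc
        simpa using hm
      · rw [A.basicSet_unique hX (h.line_mem c hc) hm ⟨d, rfl⟩, h.mem_line]
        simp
    · have hXe := A.basicSet_unique hX (hP a (d - a * (α * (c / a) ^ 2 + β * (c / a))) ha) hm
        ⟨c / a, by simp only; congr 1 <;> field_simp; ring⟩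
      rw [hXe]
      refine ⟨c / a + r / (2 * α), ?_⟩
      simp only
      congr 1
      · field_simp
        ring
      · field_simp
        ring
  · rw [A.basicSet_unique hX (hpl a b hb) hm (h.mem_plane.2 ⟨rfl, rfl⟩), h.mem_plane]
    exact ⟨rfl, rfl⟩

/-- The embedding is chosen so that the n-th point of the σ-orbit of (0,0,1) has last coordinate 2 α
n (n - 1) / 2 + (α + β) n = α n² + β n, matching the parabola. Its image lies in b = 0, so it is W.
-/
theorem exists_isomorphic_Dp (h : A.IsAdapted E U W V L)
    (h2 : (2 : ZMod p) ≠ 0) {α β : ZMod p} (hα : α ≠ 0)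
    (hP : ∀ a l, a ≠ 0 →
      Set.range (fun i => E a 0 (a * i) (a * (α * i ^ 2 + β * i) + l)) ∈ A.basicSets) :
    ∃ (U₁ : Subgroup G) (hU₁ : A.IsASubgroup U₁), Nat.card U₁ = p ^ 3 ∧
      (A.restrict U₁ hU₁).Isomorphic (Dp p) := by
  let ι : Multiplicative (Fin 3 → ZMod p) →* G := MonoidHom.mk'
    (fun v => E (v.toAdd 2) 0 (v.toAdd 1) (2 * α * v.toAdd 0 + (α + β) * v.toAdd 1)) (by
      intro v w
      rw [h.mul]
      simp only [toAdd_mul, Pi.add_apply]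
      congr 1
      · simp
      · ring)
  have hι : ∀ v, ι v = E (v.toAdd 2) 0 (v.toAdd 1) (2 * α * v.toAdd 0 + (α + β) * v.toAdd 1) :=
    fun _ => rfl
  have hinj : Function.Injective ι := by
    intro v w hvw
    rw [hι, hι] at hvw
    obtain ⟨e2, -, e1, e0⟩ := h.inj hvw
    rw [e1, add_left_inj] at e0
    apply Multiplicative.toAdd.injective
    ext i
    fin_cases i
    · exact mul_left_cancel₀ (mul_ne_zero h2 hα) e0
    · exact e1
    · exact e2
  have hσ : ∀ (n : ℕ) v, ι ((sigmaAut p ^ n) v) = E (v.toAdd 2) 0 (v.toAdd 1 + n * v.toAdd 2)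
      (2 * α * (v.toAdd 0 + n * v.toAdd 1 + n * (n - 1) / 2 * v.toAdd 2) +
        (α + β) * (v.toAdd 1 + n * v.toAdd 2)) := by
    intro n v
    rw [hι, sigmaAut_pow_apply p h2]
    simp
  obtain ⟨hU, hiso⟩ := exists_restrict_isomorphic (A := A) (B := Dp p) ι hinj (by
    rintro _ ⟨v, rfl⟩
    have hO : ι '' MulAction.orbit (Subgroup.zpowers (sigmaAut p)) v =
        Set.range fun n : ℕ => ι ((sigmaAut p ^ n) v) := by
      ext g
      simp only [Set.mem_image, mem_orbit_sigmaAut, Set.mem_range]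
      constructor
      · rintro ⟨w, ⟨n, rfl⟩, rfl⟩
        exact ⟨n, rfl⟩
      · rintro ⟨n, rfl⟩
        exact ⟨_, ⟨n, rfl⟩, rfl⟩
    change ι '' MulAction.orbit (Subgroup.zpowers (sigmaAut p)) v ∈ A.basicSets
    rw [hO]
    simp only [hσ]
    generalize v.toAdd 0 = x
    generalize v.toAdd 1 = y
    generalize v.toAdd 2 = a
    by_cases ha : a = 0
    · subst ha
      by_cases hy : y = 0
      · subst hy
        convert h.point_mem (2 * α * x) using 1
        ext g
        simp
      · convert h.line_mem y hy using 1
        apply Set.Subset.antisymm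
        · rintro _ ⟨n, rfl⟩
          rw [h.mem_line]
          simp
        · rintro _ ⟨d, rfl⟩
          refine ⟨((d - 2 * α * x - (α + β) * y) / (2 * α * y)).val, ?_⟩
          simp only [ZMod.natCast_zmod_val]
          congr 1
          · ring
          · field_simp
            ring
    · convert hP a (2 * α * x + (α + β) * y - a * (α * (y / a) ^ 2 + β * (y / a))) ha using 1
      apply Set.Subset.antisymm
      · rintro _ ⟨n, rfl⟩
        refine ⟨y / a + n, ?_⟩
        simp only
        congr 1
        · field_simp
        · field_simp
          ring
      · rintro _ ⟨i, rfl⟩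
        refine ⟨(i - y / a).val, ?_⟩
        simp only [ZMod.natCast_zmod_val]
        congr 1
        · field_simp
          ring
        · field_simp
          ring)
  refine ⟨ι.range, hU, ?_, hiso⟩
  rw [← Nat.card_congr (MonoidHom.ofInjective hinj).toEquiv]
  change Nat.card (Fin 3 → ZMod p) = p ^ 3
  simp

/-- V and a thin plane outside W span a subgroup all of whose nontrivial planes are thin multiples;
its basic sets are the points of L and the `L`-cosets outside L. -/
theorem exists_isomorphic_wreathCpCp2 (h : A.IsAdapted E U W V L) {a b : ZMod p} (hb : b ≠ 0)
    (ht : A.IsThin E a b) :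
    ∃ (U₂ : Subgroup G) (hU₂ : A.IsASubgroup U₂), Nat.card U₂ = p ^ 3 ∧
      (A.restrict U₂ hU₂).Isomorphic (wreathCpCp2 p) := by
  let ι : Cp p × (Cp p × Cp p) →* G := MonoidHom.mk'
    (fun q => E (q.2.2.toAdd * a) (q.2.2.toAdd * b) q.2.1.toAdd q.1.toAdd) (by
      intro v w
      rw [h.mul]
      simp [add_mul])
  have hι : ∀ q, ι q = E (q.2.2.toAdd * a) (q.2.2.toAdd * b) q.2.1.toAdd q.1.toAdd :=
    fun _ => rfl
  have hinj : Function.Injective ι := by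
    rintro ⟨d, c, k⟩ ⟨d', c', k'⟩ hvw
    rw [hι, hι] at hvw
    obtain ⟨-, e1, e2, e3⟩ := h.inj hvw
    obtain rfl : d = d' := Multiplicative.toAdd.injective e3
    obtain rfl : c = c' := Multiplicative.toAdd.injective e2
    obtain rfl : k = k' := Multiplicative.toAdd.injective (mul_right_cancel₀ hb e1)
    rfl
  obtain ⟨hU, hiso⟩ := exists_restrict_isomorphic (A := A) (B := wreathCpCp2 p) ι hinj (by
    rintro Y hY
    obtain ⟨y, hy⟩ := (wreathCpCp2 p).basicSet_nonempty hY
    have hYy := basicSet_wreath_groupRing _ hY hy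
    by_cases hy2 : y.2 = 1
    · rw [hYy.1 hy2, Set.image_singleton, hι, hy2]
      simpa using h.point_mem _
    · obtain ⟨Z, hZ, hyZ, rfl⟩ := hYy.2 hy2
      rw [basicSet_groupRing hZ hyZ]
      have : ι '' (Set.univ ×ˢ {y.2}) =
          Set.range (E (y.2.2.toAdd * a) (y.2.2.toAdd * b) y.2.1.toAdd) := by
        apply Set.Subset.antisymm
        · rintro _ ⟨⟨d, q⟩, ⟨-, hq⟩, rfl⟩
          obtain rfl : q = y.2 := hq
          exact ⟨d.toAdd, (hι (d, y.2)).symm⟩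
        · rintro _ ⟨d, rfl⟩
          exact ⟨(Multiplicative.ofAdd d, y.2), ⟨trivial, rfl⟩, hι _⟩
      rw [this]
      by_cases hk : y.2.2.toAdd = 0
      · rw [hk, zero_mul, zero_mul]
        refine h.line_mem _ fun hc => hy2 ?_
        exact Prod.ext (Multiplicative.toAdd.injective hc) (Multiplicative.toAdd.injective hk)
      · exact h.line_mem_of_isThin (mul_ne_zero hk hb) (h.isThin_smul ht _) _)
  refine ⟨ι.range, hU, ?_, hiso⟩
  rw [← Nat.card_congr (MonoidHom.ofInjective hinj).toEquiv, Nat.card_prod, Nat.card_prod, card_Cp]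
  ring

end Transversal

end IsAdapted

end Cases

end SRing

namespace SRing

/-! ### Uniqueness properties of exceptional pairs -/

section ExceptionalPairs

theorem Isomorphic.exists_ncard_eq {G H : Type*} [Group G] [Finite G] [Group H] [Finite H]
    {A : SRing G} {B : SRing H} (h : A.Isomorphic B) {X : Set G} (hX : X ∈ A.basicSets) :
    ∃ Y ∈ B.basicSets, Y.ncard = X.ncard := by
  obtain ⟨f, -, hf⟩ := h.exists_normalized
  exact ⟨_, (hf X hX).1, Set.ncard_image_of_injective X f.injective⟩

theorem exists_mem_restrict_image_eq {G : Type*} [Group G] [Finite G] {A : SRing G}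
    {K : Subgroup G} (hK : A.IsASubgroup K) {X : Set G} (hX : X ∈ A.basicSets)
    (hXK : X ⊆ (K : Set G)) : ∃ Y ∈ (A.restrict K hK).basicSets, ((↑) '' Y : Set G) = X := by
  have h : ((↑) '' ((↑) ⁻¹' X : Set K) : Set G) = X := by
    rw [Set.image_preimage_eq_inter_range, Subtype.range_val]
    exact Set.inter_eq_left.2 hXK
  exact ⟨_, mem_restrict_basicSets.2 (h.symm ▸ hX), h⟩

variable {G : Type*} [CommGroup G] [Finite G] {p : ℕ} [Fact p.Prime]

/-- Each basic set is a point or a coset of a subgroup of order p, and the latter has nontrivial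
radical. -/
theorem ncard_le_of_isomorphic_wreathCpCp2 {A : SRing G} {K : Subgroup G} (hK : A.IsASubgroup K)
    (hiso : (A.restrict K hK).Isomorphic (wreathCpCp2 p)) {X : Set G} (hX : X ∈ A.basicSets)
    (hXK : X ⊆ (K : Set G)) : X.ncard ≤ p ∧ (setRadical X = {1} → X.ncard = 1) := by
  have hp := (Fact.out : p.Prime)
  obtain ⟨L, hL, h1, h2⟩ := exists_subgroup_of_isomorphic_wreathCpCp2 hiso
  obtain ⟨Y, hY, rfl⟩ := exists_mem_restrict_image_eq hK hX hXK
  rw [Set.ncard_image_of_injective _ Subtype.val_injective]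
  obtain ⟨y, hy⟩ := (A.restrict K hK).basicSet_nonempty hY
  by_cases hyL : y ∈ L
  · rw [h1 Y hY y hy hyL, Set.ncard_singleton]
    exact ⟨hp.one_lt.le, fun _ => rfl⟩
  · have h3 := h2 Y hY y hy hyL
    constructor
    · have : Y = (fun l => l * y) '' (L : Set K) := by
        ext z
        rw [h3]
        constructor
        · intro hz
          exact ⟨_, hz, by simp⟩
        · rintro ⟨l, hl, rfl⟩
          simpa using hl
      rw [this, Set.ncard_image_of_injective _ (mul_left_injective y)]
      exact hL.le
    · intro hr
      exfalso
      have hLne : L ≠ ⊥ := by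
        rintro rfl
        rw [Subgroup.card_bot] at hL
        exact hp.one_lt.ne hL
      obtain ⟨⟨l, hl⟩, hl1⟩ := Subgroup.ne_bot_iff_exists_ne_one.1 hLne
      have : (l : G) ∈ setRadical ((↑) '' Y : Set G) := by
        refine mem_setRadical_of_forall ?_
        rintro _ ⟨z, hz, rfl⟩
        refine ⟨l * z, (h3 _).2 ?_, rfl⟩
        rw [mul_assoc]
        exact mul_mem hl ((h3 z).1 hz)
      rw [hr] at this
      exact hl1 (Subtype.ext (Subtype.ext this))

namespace IsAdapted

variable {A : SRing G} {E : ZMod p → ZMod p → ZMod p → ZMod p → G} {U W V L : Subgroup G}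

theorem exists_mem_of_ne (h : A.IsAdapted E U W V L) {K : Subgroup G}
    (hcard : Nat.card K = p ^ 3) (hKW : K ≠ W) : ∃ a b c d, b ≠ 0 ∧ E a b c d ∈ K := by
  by_contra! hc
  refine hKW (Subgroup.eq_of_le_of_card_ge (fun g hg => ?_) (by rw [hcard, h.card_W]))
  obtain ⟨a, b, c, d, rfl⟩ := h.surj g
  by_contra hb
  exact hc a b c d (fun hb0 => hb (h.mem_W.2 hb0)) hg

/-- An `A`-subgroup of order `p ^ 3` other than `W` with basic sets of size at most `p` contains
`V`, and its basic sets lie in cosets of `L`. -/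
theorem isThin_of_ncard_le (h : A.IsAdapted E U W V L) (hG : Nat.card G = p ^ 4)
    (hU : Nat.card U = p ^ 3) {K : Subgroup G}
    (hK : A.IsASubgroup K) (hcard : Nat.card K = p ^ 3) (hKW : K ≠ W)
    (hsmall : ∀ X ∈ A.basicSets, X ⊆ (K : Set G) → X.ncard ≤ p) :
    V ≤ K ∧ ∀ a b c d, E a b c d ∈ K → A.IsThin E a b := by
  have hp := (Fact.out : p.Prime)
  have hthin : ∀ a b c d, b ≠ 0 → E a b c d ∈ K → A.IsThin E a b := by
    intro a b c d hb hm
    refine (h.plane_mem_or_isThin a hb).resolve_left fun hpl => ?_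
    have h1 := hsmall _ hpl (hK.subset hpl (h.mem_plane.2 ⟨rfl, rfl⟩) hm)
    rw [h.ncard_plane] at h1
    exact absurd h1 (not_le.2 (lt_self_pow₀ hp.one_lt (by norm_num)))
  have hle : U ⊓ K ≤ V := by
    rintro g ⟨hgU, hgK⟩
    obtain ⟨a, b, c, d, rfl⟩ := h.surj g
    obtain rfl := h.mem_U.1 hgU
    refine h.mem_V.2 ⟨rfl, ?_⟩
    by_contra hb
    exact h.not_isThin_zero_left hb (hthin 0 b c d hb hgK)
  -- U has index p, so it meets K in at least p² elements; the intersection lies in V, hence equals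
  -- V.
  have hVK : V ≤ K := by
    have hi : U.index = p := by
      have := U.card_mul_index
      rw [hU, hG, pow_succ p 3] at this
      exact Nat.eq_of_mul_eq_mul_left (pow_pos hp.pos 3) this
    have h1 : Nat.card (U ⊓ K : Subgroup G) * U.relIndex K = p ^ 3 := by
      rw [← hcard, ← Subgroup.relIndex_bot_left, ← Subgroup.relIndex_bot_left,
        ← Subgroup.inf_relIndex_right U K]
      exact Subgroup.relIndex_mul_relIndex _ _ _ bot_le inf_le_right
    have h2 : U.relIndex K ≤ p :=
      Nat.le_of_dvd hp.pos (hi ▸ Subgroup.relIndex_dvd_index_of_normal U K)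
    have h3 : p ^ 2 ≤ Nat.card (U ⊓ K : Subgroup G) := by
      refine Nat.le_of_mul_le_mul_right ?_ hp.pos
      calc p ^ 2 * p = p ^ 3 := by ring
        _ = _ := h1.symm
        _ ≤ _ := Nat.mul_le_mul_left _ h2
    have h4 : Nat.card V = p ^ 2 := by
      have h5 : plane E 0 0 = (V : Set G) := by rw [h.plane_eq_smul, h.one, one_smul]
      have h6 := h.ncard_plane 0 0
      rwa [h5] at h6
    have h5 : U ⊓ K = V := Subgroup.eq_of_le_of_card_ge hle (by rw [h4]; exact h3)
    exact h5 ▸ inf_le_right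
  refine ⟨hVK, fun a b c d hm => ?_⟩
  by_cases hb : b = 0
  · subst hb
    by_cases ha : a = 0
    · subst ha
      exact h.isThin_zero
    · exfalso
      -- An element of K with a ≠ 0, b = 0 would cancel the first coordinate of one with b' ≠ 0,
      -- making (0, b') thin.
      obtain ⟨a', b', c', d', hb', hm'⟩ := h.exists_mem_of_ne hcard hKW
      have h1 := mul_mem hm' (K.pow_mem hm (-(a' / a)).val)
      rw [h.pow, h.mul, ZMod.natCast_zmod_val, neg_mul, div_mul_cancel₀ _ ha, add_neg_cancel,
        mul_zero, add_zero] at h1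
      exact h.not_isThin_zero_left hb' (hthin _ _ _ _ hb' h1)
  · exact hthin a b c d hb hm

/-- If K ≠ W, its basic sets lie in `L`-cosets, so quotients of two points of one basic set lie in L
and form one-point basic sets, which `Dp` forbids. -/
theorem eq_W_of_isomorphic_Dp (h : A.IsAdapted E U W V L) (hG : Nat.card G = p ^ 4)
    (hU : Nat.card U = p ^ 3) (hp2 : 2 < p) {K : Subgroup G}
    (hK : A.IsASubgroup K) (hcard : Nat.card K = p ^ 3)
    (hiso : (A.restrict K hK).Isomorphic (Dp p)) : K = W := by
  by_contra hKW
  obtain ⟨-, hthin⟩ := h.isThin_of_ncard_le hG hU hK hcard hKW fun X hX hXK => by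
    obtain ⟨Y, hY, rfl⟩ := exists_mem_restrict_image_eq hK hX hXK
    obtain ⟨Z, hZ, hZY⟩ := hiso.exists_ncard_eq hY
    rw [Set.ncard_image_of_injective _ Subtype.val_injective, ← hZY]
    exact ncard_basicSet_Dp_le p hp2 hZ
  obtain ⟨X, hX, y, hy, y', hy', hne⟩ := exists_of_isomorphic_Dp p hiso
  obtain ⟨a, b, c, d, hE⟩ := h.surj (y : G)
  have hyX : E a b c d ∈ ((↑) '' X : Set G) := hE ▸ ⟨y, hy, rfl⟩
  obtain ⟨d', hd'⟩ := hthin a b c d (hE ▸ y.2) c d _ (mem_restrict_basicSets.1 hX) hyX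
    ⟨y', hy', rfl⟩
  refine hne ?_
  rw [mem_restrict_basicSets, Set.image_singleton]
  push_cast
  rw [← hd', ← hE, h.inv, h.mul]
  simpa using h.point_mem _

/-- Outside the union of an exceptional pair, all basic sets are cosets of `V`. -/
theorem exists_eq_smul_of_isExceptionalPair (h : A.IsAdapted E U W V L) (hG : Nat.card G = p ^ 4)
    (hU : Nat.card U = p ^ 3) (hp2 : 2 < p)
    (hW : (∀ a b, b ≠ 0 → plane E a b ∈ A.basicSets) ∨
      ∃ X ∈ A.basicSets, X ⊆ (W : Set G) ∧ setRadical X = {1} ∧ X.ncard ≠ 1)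
    {U₁ U₂ : Subgroup G} (hex : IsExceptionalPair p A U₁ U₂) {Y : Set G} (hY : Y ∈ A.basicSets)
    (hYU : Y ⊆ ((U₁ : Set G) ∪ (U₂ : Set G))ᶜ) : ∃ g : G, Y = g • (V : Set G) := by
  obtain ⟨hc₁, hc₂, hU₁, hU₂, hi₁, hi₂⟩ := hex
  obtain rfl := h.eq_W_of_isomorphic_Dp hG hU hp2 hU₁ hc₁ hi₁
  obtain ⟨y, hy⟩ := A.basicSet_nonempty hY
  obtain ⟨a, b, c, d, rfl⟩ := h.surj y
  have hb : b ≠ 0 := fun hb => hYU hy (Or.inl (h.mem_W.2 hb))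
  have hgU₂ : E a b c d ∉ U₂ := fun hm => hYU hy (Or.inr hm)
  suffices plane E a b ∈ A.basicSets from
    ⟨E a b 0 0, by rw [A.basicSet_unique hY this hy (h.mem_plane.2 ⟨rfl, rfl⟩), h.plane_eq_smul]⟩
  rcases hW with hW | ⟨X, hX, hXW, hXr, hX1⟩
  · exact hW a b hb
  · refine (h.plane_mem_or_isThin a hb).resolve_right fun ht => ?_
    -- `U₁` is W, which contains a basic set of trivial radical with more than one point; `U₂` has
    -- none.
    have hne : U₂ ≠ U₁ := by
      rintro rfl
      exact hX1 ((ncard_le_of_isomorphic_wreathCpCp2 hU₂ hi₂ hX hXW).2 hXr)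
    obtain ⟨hVU₂, hthin⟩ := h.isThin_of_ncard_le hG hU hU₂ hc₂ hne fun X hX hXK =>
      (ncard_le_of_isomorphic_wreathCpCp2 hU₂ hi₂ hX hXK).1
    obtain ⟨a₀, b₀, c₀, d₀, hb₀, hm₀⟩ := h.exists_mem_of_ne hc₂ hne
    have ht₀ := hthin _ _ _ _ hm₀
    have ha₀ : a₀ ≠ 0 := by
      rintro rfl
      exact h.not_isThin_zero_left hb₀ ht₀
    -- Subtracting a multiple of the thin direction of `U₂` kills a. The rest (0, b') is thin, so b'
    -- = 0 and (a, b) is a multiple of (a₀, b₀), a plane inside `U₂`.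
    have ht' := h.isThin_add ht (h.isThin_smul ht₀ (-(a / a₀)))
    rw [neg_mul, div_mul_cancel₀ _ ha₀, add_neg_cancel] at ht'
    have hb' : b + -(a / a₀) * b₀ = 0 := by
      by_contra hb'
      exact h.not_isThin_zero_left hb' ht'
    refine hgU₂ ?_
    have h1 := U₂.pow_mem hm₀ (a / a₀).val
    rw [h.pow, ZMod.natCast_zmod_val, div_mul_cancel₀ _ ha₀] at h1
    have h2 := mul_mem h1 (hVU₂ (h.mem_V.2 ⟨rfl, rfl⟩ :
      E 0 0 (c - a / a₀ * c₀) (d - a / a₀ * d₀) ∈ V))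
    rw [h.mul] at h2
    convert h2 using 1
    congr 1
    · simp
    · linear_combination hb'
    · ring
    · ring

end IsAdapted

end ExceptionalPairs

end SRing

theorem lemma5p8 {p : ℕ} [Fact p.Prime] {G : Type*} [CommGroup G] [Finite G]
    (hexp : ∀ g : G, g ^ p = 1) (hcard : Nat.card G = p ^ 4)
    (A : SRing G) (hA : A.IsPSRing p) (hdec : A.IsDecomposable)
    (U : Subgroup G) (hU : A.IsASubgroup U)
    (hiso : (A.restrict U hU).Isomorphic (SRing.wreathCpCpCp p))
    (hrad : ∃ X ∈ A.basicSets, X ⊆ (U : Set G)ᶜ ∧ setRadical X = {1}) :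
    (inducedPerms (A.autGroup : Set (Equiv.Perm G)) U =
          ((A.restrict U hU).autGroup : Set (Equiv.Perm U)) ∨
        (2 < p ∧ ∃ U₁ U₂ : Subgroup G, SRing.IsExceptionalPair p A U₁ U₂)) ∧
      ∃ V : Subgroup G,
        (A.IsASubgroup V ∧ Nat.card V = p ^ 2 ∧ V ≤ U) ∧
        (∀ W : Subgroup G, A.IsASubgroup W → Nat.card W = p ^ 2 → W ≤ U → W = V) ∧
        (2 < p → ∀ U₁ U₂ : Subgroup G, SRing.IsExceptionalPair p A U₁ U₂ →
          ∀ Y ∈ A.basicSets, Y ⊆ ((U₁ : Set G) ∪ (U₂ : Set G))ᶜ →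
            ∃ g : G, Y = g • (V : Set G)) := by
  have hp := (Fact.out : p.Prime)
  obtain ⟨V, L, hflag⟩ := SRing.exists_isWreathFlag hU hiso
  obtain ⟨W, hW, hWU, ⟨X, hX, hXU, hXW, hXr⟩, hinv⟩ :=
    hflag.exists_complement hp hcard hdec hrad
  have hV : A.IsASubgroup V ∧ Nat.card V = p ^ 2 ∧ V ≤ U :=
    ⟨hflag.isASubgroup_V, hflag.card_V, hflag.le_U⟩
  have huniq : ∀ W : Subgroup G, A.IsASubgroup W → Nat.card W = p ^ 2 → W ≤ U → W = V :=
    fun W hW hc hWU => hflag.eq_V hp hW hc hWU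
  -- In either case the base point of the coordinates is the useful one: x with {x} a basic set
  -- here, a point of X otherwise.
  by_cases hs : ∃ x ∈ W, x ∉ U ∧ {x} ∈ A.basicSets
  · obtain ⟨x, hxW, hxU, hx⟩ := hs
    obtain ⟨E, hE, rfl⟩ := SRing.exists_isAdapted hexp hcard hA hflag hW hWU hinv hxW hxU
    refine ⟨Or.inl ((A.inducedPerms_subset hU).antisymm
      (hE.autGroup_restrict_subset_of_singleton hx)), V, hV, huniq, ?_⟩
    intro hp2 U₁ U₂ hex Y hY hYU
    exact hE.exists_eq_smul_of_isExceptionalPair hcard hflag.card_U hp2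
      (Or.inl fun a b hb => hE.plane_mem_of_singleton hx a hb) hex hY hYU
  · obtain ⟨x, hx⟩ := A.basicSet_nonempty hX
    obtain ⟨E, hE, rfl⟩ := SRing.exists_isAdapted hexp hcard hA hflag hW hWU hinv (hXW hx) (hXU hx)
    have hns : ∀ a c d, a ≠ 0 → {E a 0 c d} ∉ A.basicSets := fun a c d ha hm =>
      hs ⟨_, hE.mem_W.2 rfl, fun h => ha (hE.mem_U.1 h), hm⟩
    obtain ⟨hp2, α, β, hα, hP⟩ := hE.exists_paraboloid hcard hns hX hx hXr
    have h2 : (2 : ZMod p) ≠ 0 := by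
      have := (ZMod.natCast_eq_zero_iff 2 p).not.2 fun h => by
        have := Nat.le_of_dvd (by norm_num) h
        omega
      simpa using this
    refine ⟨?_, V, hV, huniq, ?_⟩
    · by_cases hpl : ∀ a b, b ≠ 0 → SRing.plane E a b ∈ A.basicSets
      · exact Or.inl ((A.inducedPerms_subset hU).antisymm
          (hE.autGroup_restrict_subset_of_paraboloid h2 hα hP hpl))
      · push Not at hpl
        obtain ⟨a, b, hb, hpl⟩ := hpl
        have ht := (hE.plane_mem_or_isThin a hb).resolve_left hpl
        obtain ⟨U₁, hU₁, hc₁, hi₁⟩ := hE.exists_isomorphic_Dp h2 hα hP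
        obtain ⟨U₂, hU₂, hc₂, hi₂⟩ := hE.exists_isomorphic_wreathCpCp2 hb ht
        exact Or.inr ⟨hp2, U₁, U₂, hc₁, hc₂, hU₁, hU₂, hi₁, hi₂⟩
    · intro _ U₁ U₂ hex Y hY hYU
      refine hE.exists_eq_smul_of_isExceptionalPair hcard hflag.card_U hp2
        (Or.inr ⟨X, hX, hXW, hXr, fun h1 => ?_⟩) hex hY hYU
      obtain ⟨y, rfl⟩ := Set.ncard_eq_one.1 h1
      rw [← Set.mem_singleton_iff.1 hx] at hX
      exact hns 1 0 0 one_ne_zero hX
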